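/- **Setting.** Let $n\ge1$, $d\ge2$, let $X\in\mathbb R^{n\times d}$ be a fixed design whose columns satisfy $\max_j\|X_{*j}\|_2\le\sqrt n$, let $\beta^*\in\mathbb R^d$ with support $S$ and $s=|S|$, and let $y=X\beta^*+\epsilon$, where $\epsilon_1,\dots,\epsilon_n$ are i.i.d. centred sub-Gaussian with variance proxy $\sigma^2$, i.e. $\mathbb E e^{t\epsilon_i}\le e^{\sigma^2t^2/2}$ for all $t\in\mathbb R$. Put $\mathcal L(\beta)=(2n)^{-1}\|y-X\beta\|_2^2$. For $\Lambda\in\mathbb R^d$ call $\beta$ an *$\varepsilon$-optimal solution with weights $\Lambda$* if $\min_{\xi\in\partial\|\beta\|_1}\|\nabla\mathcal L(\beta)+\Lambda\odot\xi\|_\infty\le\varepsilon$. Given $\lambda,\varepsilon_c,\varepsilon_t$ and $w$, let $\widetilde\beta^{(1)}$ be any $\varepsilon_c$-optimal solution with weights $\lambda\mathbf 1$ (or with weights $\lambda w(0)\mathbf 1$, corresponding to the initial value $\widetilde\beta^{(0)}=0$), and for $1\le\ell<T$ let $\widetilde\beta^{(\ell+1)}$ be any $\varepsilon_t$-optimal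 solution with weights $\big(\lambda w(|\widetilde\beta^{(\ell)}_j|)\big)_{j\le d}$. For $m\in\mathbb N$ and $r\in\mathbb R$ let $\rho_+(m,r)$ and $\rho_-(m,r)$ be the supremum and the infimum of $u_J^{\rm T}\nabla^2\mathcal L(\beta)u_J$ over all $u,\beta\in\mathbb R^d$ and $J\subseteq\{1,\dots,d\}$ with $\|u_J\|_2=1$, $|J|\le m$, $\|\beta-\beta^*\|_2\le r$. **Assumptions.** Let $\delta\in(0,1)$ and $0<\rho_*\le\rho^*<\infty$. (A1) There are an integer $\tilde s\ge 2s$ and some $r$ with $\rho_*\le\rho_-(2s+2\tilde s,r)\le\rho_+(2s+2\tilde s,r)\le\rho^*$ and $\rho_+(\tilde s,r)/\rho_-(2s+2\tilde s,r)\le 1+\tfrac1{100}\,\tilde s/s$. (A2) $w$ is non-increasing on $[0,\infty)$ with values in $[0,1]$ there, and $w(u)\ge\frac12$ for $u=18\rho_*^{-1}\delta^{-1}\lambda$. (A3) There is $\gamma>0$ with $\min_{j\in S}|\beta^*_j|\ge u+\gamma\lambda$ and $w(\gamma\lambda)=0$. **Claim.** For every $\delta\in(0,1)$ there is $c_T>0$,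 and for every $\sigma>0$ there is $c_0>0$, such that for all $c_2\ge c_1\ge c_0$ and $0<\rho_*\le\rho^*$ there are positive constants $\eta_1,\eta_2,K$ (depending only on $\delta,\sigma,c_1,c_2,\rho_*,\rho^*$) with the following property. In the above setting, under (A1)–(A3), if $$c_1\sqrt{\tfrac{\log d}{n}}\le\lambda\le c_2\sqrt{\tfrac{\log d}{n}},\qquad \varepsilon_c\le\tfrac{\lambda}{8},\qquad \varepsilon_t\le\sqrt{\tfrac1n},\qquad T\ge1,\quad T\ge c_T\log\log d,$$ then there is an event of probability at least $1-2d^{-\eta_1}-2\exp(-\eta_2 s)$ on which every such sequence $\widetilde\beta^{(1)},\dots,\widetilde\beta^{(T)}$ satisfies $$\|\widetilde\beta^{(T)}-\beta^*\|_2\le K\sqrt{s/n}.$$ -/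

import Mathlib

open MeasureTheory ProbabilityTheory

noncomputable section

namespace ILAMM

/-- `supp β = {j : β_j ≠ 0}`. -/
def supp {d : ℕ} (β : EuclideanSpace ℝ (Fin d)) : Finset (Fin d) :=
  Finset.univ.filter fun j => β j ≠ 0

/-- The vector `u_J`, equal to `u` on `J` and zero elsewhere. -/
def restrict {d : ℕ} (J : Finset (Fin d)) (u : EuclideanSpace ℝ (Fin d)) :
    EuclideanSpace ℝ (Fin d) :=
  WithLp.toLp 2 fun j => if j ∈ J then u j else 0

def l1Norm {d : ℕ} (β : EuclideanSpace ℝ (Fin d)) : ℝ := ∑ j, |β j|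

/-- The set of subgradients of `f` at `x₀`. -/
def subdifferential {d : ℕ} (f : EuclideanSpace ℝ (Fin d) → ℝ) (x₀ : EuclideanSpace ℝ (Fin d)) :
    Set (EuclideanSpace ℝ (Fin d)) :=
  {ξ | ∀ x, inner ℝ ξ (x - x₀) ≤ f x - f x₀}

/-- The suboptimality measure `ω_Λ(β) = min_{ξ ∈ ∂‖β‖₁} ‖∇L(β) + Λ ⊙ ξ‖_∞`
(the norm of a function `Fin d → ℝ` is the supremum norm). -/
def suboptimality {d : ℕ} (L : EuclideanSpace ℝ (Fin d) → ℝ) (Λ : Fin d → ℝ)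
    (β : EuclideanSpace ℝ (Fin d)) : ℝ :=
  sInf ((fun ξ : EuclideanSpace ℝ (Fin d) => ‖(fun j => gradient L β j + Λ j * ξ j : Fin d → ℝ)‖) ''
    subdifferential l1Norm β)

/-- `β` is an `ε`-optimal solution of `min_β L(β) + ‖Λ ⊙ β‖₁`. -/
def IsEpsOptimal {d : ℕ} (L : EuclideanSpace ℝ (Fin d) → ℝ) (Λ : Fin d → ℝ) (ε : ℝ)
    (β : EuclideanSpace ℝ (Fin d)) : Prop :=
  suboptimality L Λ β ≤ ε

/-- The tightening function class. Only the values on `[0, ∞)` ever enter, so nothing is asked of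
the values at negative arguments. -/
structure IsTighteningFunction (w : ℝ → ℝ) : Prop where
  antitone : ∀ t₁ t₂ : ℝ, 0 ≤ t₂ → t₂ ≤ t₁ → w t₁ ≤ w t₂
  nonneg : ∀ t : ℝ, 0 ≤ t → 0 ≤ w t
  le_one : ∀ t : ℝ, 0 ≤ t → w t ≤ 1

/-- The adaptive weights `(λ w(|β_1|), …, λ w(|β_d|))`. -/
def adaptiveWeights {d : ℕ} (lam : ℝ) (w : ℝ → ℝ) (β : EuclideanSpace ℝ (Fin d)) : Fin d → ℝ :=
  fun j => lam * w |β j|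

/-- `b 1, …, b T` are possible outputs of the successive stages of tightening after contraction:
`b 1` solves the contraction problem, with weights `Λ₀`, up to `εc`, and each further `b (ℓ + 1)`
solves, up to `εt`, the problem whose weights are computed from `b ℓ`. -/
structure IsTACSequence {d : ℕ} (L : EuclideanSpace ℝ (Fin d) → ℝ) (lam : ℝ) (w : ℝ → ℝ)
    (Λ₀ : Fin d → ℝ) (εc εt : ℝ) (T : ℕ) (b : ℕ → EuclideanSpace ℝ (Fin d)) : Prop where
  contraction : IsEpsOptimal L Λ₀ εc (b 1)
  tightening : ∀ ℓ : ℕ, 1 ≤ ℓ → ℓ < T →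
    IsEpsOptimal L (adaptiveWeights lam w (b ℓ)) εt (b (ℓ + 1))

/-- The quadratic form `vᵀ ∇²L(β) v`. -/
def hessianForm {d : ℕ} (L : EuclideanSpace ℝ (Fin d) → ℝ) (β v : EuclideanSpace ℝ (Fin d)) : ℝ :=
  fderiv ℝ (fderiv ℝ L) β v v

/-- The values over which the localized sparse eigenvalues are taken. -/
def localizedSparseValues {d : ℕ} (L : EuclideanSpace ℝ (Fin d) → ℝ)
    (βstar : EuclideanSpace ℝ (Fin d)) (m : ℕ) (r : ℝ) : Set ℝ :=
  {q | ∃ (J : Finset (Fin d)) (u β : EuclideanSpace ℝ (Fin d)),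
    ‖restrict J u‖ ^ 2 = 1 ∧ J.card ≤ m ∧ ‖β - βstar‖ ≤ r ∧ q = hessianForm L β (restrict J u)}

/-- `ρ₊(m, r)`. -/
def rhoPlus {d : ℕ} (L : EuclideanSpace ℝ (Fin d) → ℝ)
    (βstar : EuclideanSpace ℝ (Fin d)) (m : ℕ) (r : ℝ) : ℝ :=
  sSup (localizedSparseValues L βstar m r)

/-- `ρ₋(m, r)`. -/
def rhoMinus {d : ℕ} (L : EuclideanSpace ℝ (Fin d) → ℝ)
    (βstar : EuclideanSpace ℝ (Fin d)) (m : ℕ) (r : ℝ) : ℝ :=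
  sInf (localizedSparseValues L βstar m r)

/-- The localized sparse eigenvalue condition with bounds `ρlo`, `ρhi` and constants `c`, `C`;
here `s = ‖β*‖₀`. -/
def LSECondition {d : ℕ} (L : EuclideanSpace ℝ (Fin d) → ℝ) (βstar : EuclideanSpace ℝ (Fin d))
    (ρlo ρhi c C : ℝ) : Prop :=
  ∃ (st : ℕ) (r : ℝ),
    c * ((supp βstar).card : ℝ) ≤ (st : ℝ) ∧
    0 < ρlo ∧
    ρlo ≤ rhoMinus L βstar (2 * (supp βstar).card + 2 * st) r ∧
    rhoMinus L βstar (2 * (supp βstar).card + 2 * st) r ≤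
      rhoPlus L βstar (2 * (supp βstar).card + 2 * st) r ∧
    rhoPlus L βstar (2 * (supp βstar).card + 2 * st) r ≤ ρhi ∧
    rhoPlus L βstar st r / rhoMinus L βstar (2 * (supp βstar).card + 2 * st) r ≤
      1 + C * (st : ℝ) / ((supp βstar).card : ℝ)

/-- The quadratic loss `(2n)⁻¹ ‖y - Xβ‖₂²`. -/
def quadLoss {n d : ℕ} (X : Matrix (Fin n) (Fin d) ℝ) (y : EuclideanSpace ℝ (Fin n))
    (β : EuclideanSpace ℝ (Fin d)) : ℝ :=
  (2 * (n : ℝ))⁻¹ * ‖y - Matrix.toEuclideanLin X β‖ ^ 2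

/-- The response vector `y = Xβ* + e` of the linear model. -/
def response {n d : ℕ} (X : Matrix (Fin n) (Fin d) ℝ) (βstar : EuclideanSpace ℝ (Fin d))
    (e : Fin n → ℝ) : EuclideanSpace ℝ (Fin n) :=
  Matrix.toEuclideanLin X βstar + WithLp.toLp 2 e

end ILAMM

end

/-! Put `A = X/√n`. The loss is quadratic, so `‖A(β - β*)‖²` equals `⟨∇L(β) - ∇L(β*), β - β*⟩`.
Approximate stationarity turns this into `basic_inequality`: if the weights are at least `λ/2` off a
set `E ⊇ S` with `|E| ≤ 2s`, the error lies in an `ℓ¹` cone around `E`. On that cone the sparse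
eigenvalue condition acts as strong convexity (`norm_le_of_cone`). The error is then controlled by
the score on `E`, the tolerance and the weights on `S`.

For the contraction stage, with `E = S`, this gives an error of order `λ√s`. A tightening stage adds
to `S` the false discoveries, that is, the coordinates off `S` where the previous iterate exceeds
`u`. Each false discovery, and each coordinate of `S` whose weight does not vanish, carries a
previous error of at least `u`. Since `u` is a large multiple of `λ/ρ_*`, together they cost only a
fraction of the previous error. Hence `tightening_bound`: new error ≤ oracle noise + 3/4 of the old
error. About `log log d` stages remove the factor `√(log d)` hidden in `λ`.

Two events suffice: every score coordinate is below `λ/16` (a union bound), and the score on `S` has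
squared norm `O(s/n)` without a logarithm (`measure_quadratic_ge_le`, by comparison with a Gaussian
vector). -/

namespace ILAMM

/-! ### Decomposition into blocks of decreasing coordinates. -/

section Shelling

variable {ι : Type*} [DecidableEq ι]

theorem exists_top_subset (a : ι → ℝ) (F : Finset ι) :
    ∀ m : ℕ, m ≤ F.card → ∃ J ⊆ F, J.card = m ∧ ∀ j ∈ J, ∀ k ∈ F \ J, a k ≤ a j
  | 0, _ => ⟨∅, by simp, by simp, by simp⟩
  | m + 1, hm => by
    obtain ⟨J, hJF, hJ, htop⟩ := exists_top_subset a F m (by omega)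
    have hne : (F \ J).Nonempty := by
      rw [← Finset.card_pos, Finset.card_sdiff_of_subset hJF]
      omega
    obtain ⟨k, hk, hmax⟩ := Finset.exists_max_image (F \ J) a hne
    have hk' := Finset.mem_sdiff.1 hk
    refine ⟨insert k J, Finset.insert_subset hk'.1 hJF, ?_, ?_⟩
    · rw [Finset.card_insert_of_notMem hk'.2, hJ]
    · intro j hj l hl
      have hl' : l ∈ F \ J := by
        simp only [Finset.mem_sdiff, Finset.mem_insert, not_or] at hl ⊢
        exact ⟨hl.1, hl.2.2⟩
      rcases Finset.mem_insert.1 hj with rfl | hj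
      · exact hmax l hl'
      · exact htop j hj l hl'

/-- Either `F` has at most `m` elements, or its `m` largest values dominate the rest on average. -/
theorem exists_dominating_subset (a : ι → ℝ) (ha : ∀ j, 0 ≤ a j) (F : Finset ι) {m : ℕ}
    (hm : 0 < m) :
    ∃ J ⊆ F, J.card ≤ m ∧ (F.Nonempty → J.Nonempty) ∧
      ∃ b : ℝ, 0 ≤ b ∧ (∀ k ∈ F \ J, a k ≤ b) ∧ m * b ≤ ∑ j ∈ J, a j := by
  rcases le_or_gt F.card m with h | h
  · refine ⟨F, subset_rfl, h, id, 0, le_rfl, by simp, ?_⟩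
    simpa using Finset.sum_nonneg fun j _ => ha j
  · obtain ⟨J, hJF, hJ, htop⟩ := exists_top_subset a F m h.le
    have hJne : J.Nonempty := by rw [← Finset.card_pos]; omega
    obtain ⟨j₀, hj₀, hmin⟩ := Finset.exists_min_image J a hJne
    refine ⟨J, hJF, hJ.le, fun _ => hJne, a j₀, ha j₀, fun k hk => htop j₀ hj₀ k hk, ?_⟩
    have := Finset.card_nsmul_le_sum J a (a j₀) hmin
    rwa [hJ, nsmul_eq_mul] at this

/-- A subadditive set function that is controlled by the supremum of `a` on sets of at most `m`
elements is controlled by the `ℓ¹` norm of `a` on all sets. -/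
theorem shelling (a : ι → ℝ) (ha : ∀ j, 0 ≤ a j) {m : ℕ} (hm : 0 < m) (φ : Finset ι → ℝ)
    (hφ : ∀ K L, Disjoint K L → φ (K ∪ L) ≤ φ K + φ L) {M : ℝ} (hM : 0 ≤ M) (F : Finset ι)
    (hK : ∀ K ⊆ F, K.card ≤ m → ∀ b : ℝ, 0 ≤ b → (∀ j ∈ K, a j ≤ b) → φ K ≤ M * b)
    {B : ℝ} (hB : 0 ≤ B) (haB : ∀ j ∈ F, a j ≤ B) :
    φ F ≤ M * (B + (∑ j ∈ F, a j) / m) := by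
  -- Peel off the `m` largest values. Their sup is at most `B`, and the sup of what remains is at
  -- most the average over the block just removed, so the sups add up to `B` plus the `ℓ¹` norm over
  -- `m`.
  induction F using Finset.strongInduction generalizing B with
  | H F ih =>
    have hm' : (0 : ℝ) < m := by exact_mod_cast hm
    rcases F.eq_empty_or_nonempty with rfl | hF
    · simpa using hK ∅ subset_rfl (by simp) B hB (by simp)
    obtain ⟨J, hJF, hJ, hJne, b, hb, hdom, hmb⟩ := exists_dominating_subset a ha F hm
    have hss : F \ J ⊂ F := Finset.sdiff_ssubset hJF (hJne hF)
    have h₁ := ih (F \ J) hss (fun K hKF => hK K (hKF.trans hss.subset)) hb hdom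
    have h₂ := hK J hJF hJ B hB fun j hj => haB j (hJF hj)
    have h₃ := hφ J (F \ J) Finset.disjoint_sdiff
    rw [Finset.union_sdiff_of_subset hJF] at h₃
    have hsum := Finset.sum_sdiff (f := a) hJF
    have hb' : b ≤ (∑ j ∈ J, a j) / m := by rw [le_div_iff₀ hm']; linarith
    calc φ F ≤ M * B + M * (b + (∑ j ∈ F \ J, a j) / m) := by linarith
      _ = M * (B + (b + (∑ j ∈ F \ J, a j) / m)) := by ring
      _ ≤ M * (B + (∑ j ∈ F, a j) / m) := by
        gcongr
        rw [← hsum, add_div]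
        linarith

end Shelling

/-! ### Restriction of vectors to coordinate sets. -/

section Restrict

variable {d : ℕ}

theorem restrict_apply (J : Finset (Fin d)) (u : EuclideanSpace ℝ (Fin d)) (j : Fin d) :
    restrict J u j = if j ∈ J then u j else 0 := rfl

theorem norm_restrict_sq (J : Finset (Fin d)) (u : EuclideanSpace ℝ (Fin d)) :
    ‖restrict J u‖ ^ 2 = ∑ j ∈ J, u j ^ 2 := by
  rw [EuclideanSpace.real_norm_sq_eq]
  simp [restrict_apply, ite_pow, Finset.sum_ite_mem]

theorem norm_restrict (J : Finset (Fin d)) (u : EuclideanSpace ℝ (Fin d)) :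
    ‖restrict J u‖ = √(∑ j ∈ J, u j ^ 2) := by
  rw [← norm_restrict_sq, Real.sqrt_sq (norm_nonneg _)]

theorem restrict_union {K L : Finset (Fin d)} (h : Disjoint K L) (u : EuclideanSpace ℝ (Fin d)) :
    restrict (K ∪ L) u = restrict K u + restrict L u := by
  ext j
  simp only [restrict_apply, PiLp.add_apply, Finset.mem_union]
  by_cases hK : j ∈ K
  · simp [hK, Finset.disjoint_left.1 h hK]
  · simp [hK]

theorem restrict_smul (J : Finset (Fin d)) (t : ℝ) (u : EuclideanSpace ℝ (Fin d)) :
    restrict J (t • u) = t • restrict J u := by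
  ext j
  simp [restrict_apply]

theorem restrict_univ (u : EuclideanSpace ℝ (Fin d)) : restrict Finset.univ u = u := by
  ext j
  simp [restrict_apply]

theorem norm_restrict_mono {J K : Finset (Fin d)} (h : J ⊆ K) (u : EuclideanSpace ℝ (Fin d)) :
    ‖restrict J u‖ ≤ ‖restrict K u‖ := by
  rw [norm_restrict, norm_restrict]
  exact Real.sqrt_le_sqrt (Finset.sum_le_sum_of_subset_of_nonneg h fun _ _ _ => sq_nonneg _)

theorem norm_restrict_le (J : Finset (Fin d)) (u : EuclideanSpace ℝ (Fin d)) :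
    ‖restrict J u‖ ≤ ‖u‖ := by
  simpa [restrict_univ] using norm_restrict_mono (Finset.subset_univ J) u

end Restrict

/-! ### Strong convexity on the cone from sparse eigenvalues. -/

section RestrictedEigenvalue

variable {d : ℕ} {W : Type*} [NormedAddCommGroup W] [InnerProductSpace ℝ W]
  (A : EuclideanSpace ℝ (Fin d) →ₗ[ℝ] W)

/-- The correlation between the images of two vectors with disjoint sparse supports. -/
theorem inner_sq_mul_le {s m : ℕ} {ρ ρ' : ℝ}
    (hlo : ∀ J u, J.card ≤ 2 * s + 2 * m → ρ * ‖restrict J u‖ ^ 2 ≤ ‖A (restrict J u)‖ ^ 2)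
    (hhi : ∀ J u, J.card ≤ m → ‖A (restrict J u)‖ ^ 2 ≤ ρ' * ‖restrict J u‖ ^ 2)
    (hρ' : ρ' ≤ ρ * (1 + m / (100 * s))) {I K : Finset (Fin d)} (hI : I.card ≤ 2 * s + m)
    (hK : K.card ≤ m) (hIK : Disjoint I K) (v : EuclideanSpace ℝ (Fin d)) :
    inner ℝ (A (restrict I v)) (A (restrict K v)) ^ 2 * ‖restrict I v‖ ^ 2 ≤
      m / (400 * s) * ‖restrict K v‖ ^ 2 * (‖A (restrict I v)‖ ^ 2) ^ 2 := by
  set p := ‖restrict I v‖ ^ 2 with hp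
  set q := ‖restrict K v‖ ^ 2 with hq
  set x := ‖A (restrict I v)‖ ^ 2 with hx
  set y := inner ℝ (A (restrict I v)) (A (restrict K v)) with hy
  have hp0 : 0 ≤ p := sq_nonneg _
  have hq0 : 0 ≤ q := sq_nonneg _
  have hxp : ρ * p ≤ x := hlo I v (by omega)
  have hAK : ‖A (restrict K v)‖ ^ 2 ≤ ρ' * q := hhi K v hK
  -- The form `‖A u‖² - ρ‖u‖²` is nonnegative along the line `u = v_I + t v_K`. Its discriminant
  -- then bounds the correlation `y` by the gap `ρ' - ρ`.
  have hpoly : ∀ t : ℝ, 0 ≤ ((ρ' - ρ) * q) * (t * t) + (2 * y) * t + (x - ρ * p) := by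
    intro t
    set u : EuclideanSpace ℝ (Fin d) := restrict I v + t • restrict K v with hu
    have hru : restrict (I ∪ K) u = u := by
      ext j
      simp only [hu, restrict_apply, Finset.mem_union, PiLp.add_apply, PiLp.smul_apply,
        smul_eq_mul]
      by_cases h₁ : j ∈ I <;> by_cases h₂ : j ∈ K <;> simp [h₁, h₂]
    have hcard : (I ∪ K).card ≤ 2 * s + 2 * m := (Finset.card_union_le I K).trans (by omega)
    have h := hlo (I ∪ K) u hcard
    rw [hru] at h
    have hinner : inner ℝ (restrict I v) (restrict K v) = 0 := by
      rw [PiLp.inner_apply]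
      refine Finset.sum_eq_zero fun j _ => ?_
      by_cases h₁ : j ∈ I
      · simp [restrict_apply, h₁, Finset.disjoint_left.1 hIK h₁]
      · simp [restrict_apply, h₁]
    have hn : ‖u‖ ^ 2 = p + t ^ 2 * q := by
      rw [hu, norm_add_sq_real, inner_smul_right, hinner, norm_smul, mul_pow, Real.norm_eq_abs,
        sq_abs]
      ring
    have hAn : ‖A u‖ ^ 2 = x + 2 * t * y + t ^ 2 * ‖A (restrict K v)‖ ^ 2 := by
      rw [hu, map_add, map_smul, norm_add_sq_real, inner_smul_right, norm_smul, mul_pow,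
        Real.norm_eq_abs, sq_abs]
      ring
    rw [hn, hAn] at h
    nlinarith [mul_le_mul_of_nonneg_left hAK (sq_nonneg t)]
  have hdisc := discrim_le_zero hpoly
  rw [discrim] at hdisc
  have h₁ : y ^ 2 ≤ (ρ' - ρ) * q * (x - ρ * p) := by linarith
  have hQ : 0 ≤ q * (x - ρ * p) := mul_nonneg hq0 (by linarith)
  have h₂ : (ρ' - ρ) * q * (x - ρ * p) ≤ ρ * (m / (100 * s)) * (q * (x - ρ * p)) := by
    rw [mul_assoc]
    exact mul_le_mul_of_nonneg_right (by linarith) hQ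
  have h₃ : ρ * p * (x - ρ * p) ≤ x ^ 2 / 4 := by nlinarith [sq_nonneg (x - 2 * (ρ * p))]
  have hms : (0 : ℝ) ≤ m / (100 * s) * q := by positivity
  calc y ^ 2 * p ≤ ρ * (m / (100 * s)) * (q * (x - ρ * p)) * p := by gcongr; linarith
    _ = (m / (100 * s) * q) * (ρ * p * (x - ρ * p)) := by ring
    _ ≤ (m / (100 * s) * q) * (x ^ 2 / 4) := by gcongr
    _ = m / (400 * s) * q * x ^ 2 := by ring

/-- Let `I` be `E` together with the `m` largest coordinates outside it. The eigenvalue ratio keeps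
the correlation of the tail with `A v_I` below 3/10 of `‖A v_I‖²`, so Cauchy–Schwarz gives `‖A v‖² ≥
(7/10)² ‖A v_I‖²`. The lower eigenvalue bound on `I` thus passes to `v`, and the cone makes `v_I`
carry a fixed share of `‖v‖`. -/
theorem norm_le_of_cone {s m : ℕ} (hs : 0 < s) (hm : 2 * s ≤ m) {ρ ρ' : ℝ} (hρ : 0 < ρ)
    (hlo : ∀ J u, J.card ≤ 2 * s + 2 * m → ρ * ‖restrict J u‖ ^ 2 ≤ ‖A (restrict J u)‖ ^ 2)
    (hhi : ∀ J u, J.card ≤ m → ‖A (restrict J u)‖ ^ 2 ≤ ρ' * ‖restrict J u‖ ^ 2)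
    (hρ' : ρ' ≤ ρ * (1 + m / (100 * s))) {E : Finset (Fin d)} (hE : E.card ≤ 2 * s)
    {v : EuclideanSpace ℝ (Fin d)} (hcone : ∑ j ∈ Eᶜ, |v j| ≤ 6 * √s * ‖restrict E v‖)
    {a : ℝ} (ha : 0 ≤ a) (hquad : ‖A v‖ ^ 2 ≤ a * ‖restrict E v‖) : ρ * ‖v‖ ≤ 9 * a := by
  have hs' : (0 : ℝ) < s := by exact_mod_cast hs
  have hm' : (2 : ℝ) * s ≤ m := by exact_mod_cast hm
  have hm0 : 0 < m := by omega
  have hm0' : (0 : ℝ) < m := by exact_mod_cast hm0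
  obtain ⟨J, hJE, hJ, -, b, hb, hdom, hmb⟩ :=
    exists_dominating_subset (fun j => |v j|) (fun j => abs_nonneg _) Eᶜ hm0
  set I := E ∪ J with hIdef
  have hI : I.card ≤ 2 * s + m := (Finset.card_union_le E J).trans (by omega)
  have hIR : Disjoint I (Eᶜ \ J) := by
    rw [Finset.disjoint_left]
    intro j h₁ h₂
    simp only [hIdef, Finset.mem_union, Finset.mem_sdiff, Finset.mem_compl] at h₁ h₂
    tauto
  have hIu : I ∪ (Eᶜ \ J) = Finset.univ := by
    ext j
    simp only [hIdef, Finset.mem_union, Finset.mem_sdiff, Finset.mem_compl, Finset.mem_univ,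
      iff_true]
    tauto
  have hv : v = restrict I v + restrict (Eᶜ \ J) v := by
    rw [← restrict_union hIR, hIu, restrict_univ]
  set P := ‖restrict I v‖ with hP
  set x := ‖A (restrict I v)‖ ^ 2 with hx
  have hEP : ‖restrict E v‖ ≤ P := norm_restrict_mono Finset.subset_union_left v
  have hsumsplit := Finset.sum_sdiff (f := fun j => |v j|) hJE
  have hsum0 : 0 ≤ ∑ j ∈ Eᶜ \ J, |v j| := Finset.sum_nonneg fun j _ => abs_nonneg _
  have hsumJ0 : 0 ≤ ∑ j ∈ J, |v j| := Finset.sum_nonneg fun j _ => abs_nonneg _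
  set N₁ := ∑ j ∈ Eᶜ, |v j| with hN
  -- the tail
  have htail : ‖restrict (Eᶜ \ J) v‖ ^ 2 ≤ 18 * P ^ 2 := by
    have h₁ : ‖restrict (Eᶜ \ J) v‖ ^ 2 ≤ b * ∑ j ∈ Eᶜ \ J, |v j| := by
      rw [norm_restrict_sq, Finset.mul_sum]
      refine Finset.sum_le_sum fun j hj => ?_
      rw [← sq_abs, sq]
      exact mul_le_mul_of_nonneg_right (hdom j hj) (abs_nonneg _)
    have h₂ : m * (b * ∑ j ∈ Eᶜ \ J, |v j|) ≤ N₁ ^ 2 := by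
      calc m * (b * ∑ j ∈ Eᶜ \ J, |v j|) = (m * b) * ∑ j ∈ Eᶜ \ J, |v j| := by ring
        _ ≤ N₁ * N₁ := by
          apply mul_le_mul _ _ hsum0 <;> linarith
        _ = N₁ ^ 2 := by ring
    have h₃ : N₁ ^ 2 ≤ 36 * s * P ^ 2 := by
      calc N₁ ^ 2 ≤ (6 * √s * P) ^ 2 := by
            apply pow_le_pow_left₀ (by linarith)
            exact hcone.trans (by gcongr)
        _ = 36 * (√s) ^ 2 * P ^ 2 := by ring
        _ = 36 * s * P ^ 2 := by rw [Real.sq_sqrt hs'.le]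
    have h₄ : m * ‖restrict (Eᶜ \ J) v‖ ^ 2 ≤ m * (18 * P ^ 2) := by
      have := mul_le_mul_of_nonneg_left h₁ hm0'.le
      nlinarith [sq_nonneg P]
    exact le_of_mul_le_mul_left h₄ hm0'
  have hnorm : ‖v‖ ^ 2 ≤ 19 * P ^ 2 := by
    have h₁ : ‖v‖ ^ 2 = P ^ 2 + ‖restrict (Eᶜ \ J) v‖ ^ 2 := by
      rw [hP, norm_restrict_sq, norm_restrict_sq, ← Finset.sum_union hIR, hIu,
        EuclideanSpace.real_norm_sq_eq]
    linarith
  rcases (norm_nonneg (restrict I v)).eq_or_lt with h0 | hP0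
  · have : ‖v‖ ^ 2 ≤ 0 := by rw [hP, ← h0] at hnorm; simpa using hnorm
    have hv0 : ‖v‖ = 0 := by nlinarith [norm_nonneg v]
    rw [hv0]; linarith
  rw [← hP] at hP0
  have hxP : ρ * P ^ 2 ≤ x := hlo I v (by omega)
  have hx0 : 0 < x := lt_of_lt_of_le (by positivity) hxP
  -- the cross term
  have hcross : P * |inner ℝ (A (restrict I v)) (A (restrict (Eᶜ \ J) v))| ≤ 3 / 10 * x * P := by
    have hshell := shelling (fun j => |v j|) (fun j => abs_nonneg _) hm0
      (fun K => P * |inner ℝ (A (restrict I v)) (A (restrict K v))|) ?_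
      (M := x * m / (20 * √s)) (by positivity) (Eᶜ \ J) ?_ hb hdom
    · refine hshell.trans ?_
      -- The block `J` pays for the first sup `b`, so the whole `ℓ¹` norm over `m` suffices. The
      -- cone constant 6 against the 20 in `M` gives 3/10.
      have h₁ : b + (∑ j ∈ Eᶜ \ J, |v j|) / m ≤ N₁ / m := by
        rw [le_div_iff₀ hm0', add_mul, div_mul_cancel₀ _ hm0'.ne']
        linarith
      calc x * m / (20 * √s) * (b + (∑ j ∈ Eᶜ \ J, |v j|) / m)
          ≤ x * m / (20 * √s) * (6 * √s * P / m) := by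
            gcongr
            exact h₁.trans (by gcongr; exact hcone.trans (by gcongr))
        _ = 3 / 10 * x * P := by
          have : √(s : ℝ) ≠ 0 := (Real.sqrt_pos.2 hs').ne'
          field_simp
          norm_num
    · intro K L hKL
      rw [restrict_union hKL, map_add, inner_add_right, ← mul_add]
      gcongr
      exact abs_add_le _ _
    · intro K hKF hK c hc hKc
      have h₁ := inner_sq_mul_le A hlo hhi hρ' hI hK (hIR.mono_right hKF) v
      have h₂ : ‖restrict K v‖ ^ 2 ≤ m * c ^ 2 := by
        rw [norm_restrict_sq]
        calc ∑ j ∈ K, v j ^ 2 ≤ K.card • c ^ 2 := Finset.sum_le_card_nsmul _ _ _ fun j hj => by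
              rw [← sq_abs]; exact pow_le_pow_left₀ (abs_nonneg _) (hKc j hj) 2
          _ ≤ m * c ^ 2 := by rw [nsmul_eq_mul]; gcongr
      apply le_of_sq_le_sq _ (by positivity)
      rw [mul_pow, sq_abs]
      calc P ^ 2 * inner ℝ (A (restrict I v)) (A (restrict K v)) ^ 2
          ≤ m / (400 * s) * ‖restrict K v‖ ^ 2 * x ^ 2 := by rw [mul_comm]; exact h₁
        _ ≤ m / (400 * s) * (m * c ^ 2) * x ^ 2 := by gcongr
        _ = (x * m / (20 * √s) * c) ^ 2 := by
          rw [mul_pow, div_pow, mul_pow 20, Real.sq_sqrt hs'.le]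
          field_simp
          ring
  have hcross' : |inner ℝ (A (restrict I v)) (A (restrict (Eᶜ \ J) v))| ≤ 3 / 10 * x :=
    le_of_mul_le_mul_left (by linarith) hP0
  have hinner : 7 / 10 * x ≤ inner ℝ (A (restrict I v)) (A v) := by
    have : inner ℝ (A (restrict I v)) (A v) =
        x + inner ℝ (A (restrict I v)) (A (restrict (Eᶜ \ J) v)) := by
      conv_lhs => rw [hv]
      rw [map_add, inner_add_right, ← hv, real_inner_self_eq_norm_sq]
    rw [this]
    linarith [(abs_le.1 hcross').1]
  have hcs : (7 / 10 * x) ^ 2 ≤ x * ‖A v‖ ^ 2 := by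
    have h₁ := real_inner_le_norm (A (restrict I v)) (A v)
    calc (7 / 10 * x) ^ 2 ≤ (‖A (restrict I v)‖ * ‖A v‖) ^ 2 :=
          pow_le_pow_left₀ (by positivity) (hinner.trans h₁) 2
      _ = x * ‖A v‖ ^ 2 := by rw [mul_pow]
  have hAv : 49 / 100 * x ≤ ‖A v‖ ^ 2 := by
    refine le_of_mul_le_mul_left ?_ hx0
    linarith
  have hPa : 49 / 100 * (ρ * P) ≤ a := by
    refine le_of_mul_le_mul_right ?_ hP0
    have : a * ‖restrict E v‖ ≤ a * P := by gcongr
    nlinarith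
  -- `(22/5)² ≥ 19`, and `(22/5)/(49/100)` is just below 9.
  have hvP : ‖v‖ ≤ 22 / 5 * P := by
    apply le_of_sq_le_sq _ (by positivity)
    nlinarith [sq_nonneg P]
  have : ρ * ‖v‖ ≤ ρ * (22 / 5 * P) := by gcongr
  linarith

end RestrictedEigenvalue

/-! ### Linear and quadratic forms in sub-Gaussian noise. -/

section Noise

open scoped NNReal ENNReal

/-- The weight `exp(z²/4)` halves the Gaussian exponent, which leaves `√2` times the density of
variance 2. -/
theorem integral_exp_sq_div_four_gaussianReal :
    Integrable (fun z : ℝ => Real.exp (z ^ 2 / 4)) (gaussianReal 0 1) ∧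
      ∫ z : ℝ, Real.exp (z ^ 2 / 4) ∂gaussianReal 0 1 = √2 := by
  have key : ∀ z : ℝ, gaussianPDFReal 0 1 z * Real.exp (z ^ 2 / 4) =
      √2 * gaussianPDFReal 0 2 z := by
    intro z
    have h2 : √(2 * Real.pi * (2 : ℝ)) = √2 * √(2 * Real.pi) := by
      rw [mul_comm, Real.sqrt_mul (by norm_num)]
    simp only [gaussianPDFReal, NNReal.coe_one, NNReal.coe_ofNat, sub_zero, mul_one]
    rw [h2, mul_inv, mul_assoc, ← Real.exp_add, ← mul_assoc, ← mul_assoc,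
      mul_inv_cancel₀ (by positivity), one_mul]
    congr 2
    ring
  constructor
  · rw [gaussianReal_of_var_ne_zero 0 one_ne_zero,
      integrable_withDensity_iff_integrable_smul' (measurable_gaussianPDF 0 1)
        (ae_of_all _ fun _ => gaussianPDF_lt_top)]
    simp only [toReal_gaussianPDF, smul_eq_mul, key]
    exact (integrable_gaussianPDFReal 0 2).const_mul _
  · rw [integral_gaussianReal_eq_integral_smul one_ne_zero]
    simp only [smul_eq_mul, key]
    rw [integral_const_mul, integral_gaussianPDFReal_eq_one 0 two_ne_zero, mul_one]

theorem integral_exp_mul_gaussianReal (t : ℝ) :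
    Integrable (fun z : ℝ => Real.exp (t * z)) (gaussianReal 0 1) ∧
      ∫ z : ℝ, Real.exp (t * z) ∂gaussianReal 0 1 = Real.exp (t ^ 2 / 2) := by
  have h := congrFun (mgf_fun_id_gaussianReal (μ := 0) (v := 1)) t
  simp only [mgf, zero_mul, NNReal.coe_one, one_mul, zero_add] at h
  exact ⟨integrable_exp_mul_gaussianReal t, h⟩

variable {Ω : Type*} [MeasurableSpace Ω] {μ : Measure Ω}
  {κ ι : Type*} [Fintype κ] [Fintype ι]

theorem lintegral_pi_gaussian {f : ι → ℝ → ℝ} (hf : ∀ j z, 0 ≤ f j z)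
    (hint : ∀ j, Integrable (f j) (gaussianReal 0 1)) :
    ∫⁻ z : ι → ℝ, ENNReal.ofReal (∏ j, f j (z j)) ∂Measure.pi (fun _ => gaussianReal 0 1) =
      ENNReal.ofReal (∏ j, ∫ z, f j z ∂gaussianReal 0 1) := by
  rw [← ofReal_integral_eq_lintegral_ofReal (Integrable.fintype_prod hint)
    (ae_of_all _ fun z => Finset.prod_nonneg fun j _ => hf j _), integral_fintype_prod_eq_prod]

theorem hasSubgaussianMGF_linear {e : κ → Ω → ℝ} (hind : iIndepFun e μ) {c : ℝ≥0}
    (hsub : ∀ i, HasSubgaussianMGF (e i) c μ) (b : κ → ℝ) {v : ℝ≥0} (hv : c * ∑ i, b i ^ 2 ≤ v) :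
    HasSubgaussianMGF (fun ω => ∑ i, b i * e i ω) v μ := by
  have hb : ∀ i, HasSubgaussianMGF (fun ω => b i * e i ω) (Real.toNNReal (b i ^ 2) * c) μ := by
    intro i
    have h := (hsub i).const_mul (b i)
    refine ⟨h.integrable_exp_mul, fun u => (h.mgf_le u).trans (le_of_eq ?_)⟩
    rw [NNReal.coe_mul (Real.toNNReal _), Real.coe_toNNReal _ (sq_nonneg _)]
    rfl
  have h := HasSubgaussianMGF.sum_of_iIndepFun (s := Finset.univ)
    (hind.comp (fun i x => b i * x) fun i => measurable_const_mul (b i)) fun i _ => hb i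
  refine ⟨h.integrable_exp_mul, fun u => (h.mgf_le u).trans (Real.exp_le_exp.2 ?_)⟩
  have hc : ((∑ i, Real.toNNReal (b i ^ 2) * c : ℝ≥0) : ℝ) = c * ∑ i, b i ^ 2 := by
    rw [← Finset.sum_mul, mul_comm, NNReal.coe_mul, NNReal.coe_sum]
    simp only [Real.coe_toNNReal _ (sq_nonneg _)]
  rw [hc]
  gcongr

theorem lintegral_exp_linear_le {e : κ → Ω → ℝ} (hind : iIndepFun e μ) {c : ℝ≥0}
    (hsub : ∀ i, HasSubgaussianMGF (e i) c μ) (b : κ → ℝ) :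
    ∫⁻ ω, ENNReal.ofReal (Real.exp (∑ i, b i * e i ω)) ∂μ ≤
      ENNReal.ofReal (Real.exp (c * (∑ i, b i ^ 2) / 2)) := by
  have hnn : 0 ≤ c * ∑ i, b i ^ 2 :=
    mul_nonneg c.2 (Finset.sum_nonneg fun i _ => sq_nonneg _)
  have h := hasSubgaussianMGF_linear hind hsub b (v := Real.toNNReal (c * ∑ i, b i ^ 2))
    (Real.le_coe_toNNReal _)
  have hint := h.integrable_exp_mul 1
  have hle := h.mgf_le 1
  simp only [mgf, one_mul, Real.coe_toNNReal _ hnn, one_pow, mul_one] at hint hle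
  rw [← ofReal_integral_eq_lintegral_ofReal hint (ae_of_all _ fun _ => (Real.exp_pos _).le)]
  exact ENNReal.ofReal_le_ofReal hle

variable [IsProbabilityMeasure μ]

/-- Exponential moment of a quadratic form of independent sub-Gaussian variables, by comparison
with a Gaussian vector. -/
theorem lintegral_exp_quadratic_le {e : κ → Ω → ℝ} (hind : iIndepFun e μ) {c : ℝ≥0}
    (hsub : ∀ i, HasSubgaussianMGF (e i) c μ) (B : κ → ι → ℝ)
    (hB : ∀ z : ι → ℝ, c * ∑ i, (∑ j, B i j * z j) ^ 2 ≤ (∑ j, z j ^ 2) / 2) :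
    ∫⁻ ω, ENNReal.ofReal (Real.exp ((∑ j, (∑ i, B i j * e i ω) ^ 2) / 2)) ∂μ ≤
      ENNReal.ofReal (√2 ^ Fintype.card ι) := by
  set γ : Measure (ι → ℝ) := Measure.pi fun _ => gaussianReal 0 1 with hγ
  -- The exponential of a square is a Gaussian average of exponentials of linear forms. After
  -- exchanging the integrals, only the sub-Gaussian bound for linear forms is needed.
  have h₁ : ∀ ω, ENNReal.ofReal (Real.exp ((∑ j, (∑ i, B i j * e i ω) ^ 2) / 2)) =
      ∫⁻ z, ENNReal.ofReal (Real.exp (∑ i, (∑ j, B i j * z j) * e i ω)) ∂γ := by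
    intro ω
    have h := lintegral_pi_gaussian (f := fun j z => Real.exp ((∑ i, B i j * e i ω) * z))
      (fun _ _ => (Real.exp_pos _).le) fun j => (integral_exp_mul_gaussianReal _).1
    simp only [(integral_exp_mul_gaussianReal _).2, ← Real.exp_sum, ← Finset.sum_div] at h
    rw [← h]
    refine lintegral_congr fun z => ?_
    congr 2
    simp only [Finset.sum_mul]
    rw [Finset.sum_comm]
    exact Finset.sum_congr rfl fun i _ => Finset.sum_congr rfl fun j _ => by ring
  have h₂ := lintegral_pi_gaussian (ι := ι) (f := fun _ z => Real.exp (z ^ 2 / 4))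
      (fun _ _ => (Real.exp_pos _).le) fun j => integral_exp_sq_div_four_gaussianReal.1
  simp only [integral_exp_sq_div_four_gaussianReal.2, ← Real.exp_sum, ← Finset.sum_div,
    Finset.prod_const, Finset.card_univ] at h₂
  simp_rw [h₁]
  rw [lintegral_lintegral_swap, ← h₂]
  · refine lintegral_mono fun z => (lintegral_exp_linear_le hind hsub _).trans ?_
    refine ENNReal.ofReal_le_ofReal (Real.exp_le_exp.2 ?_)
    linarith [hB z]
  · have he : ∀ i, AEMeasurable (fun p : Ω × (ι → ℝ) => e i p.1) (μ.prod γ) := fun i =>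
      (hsub i).aemeasurable.comp_fst
    refine (Real.measurable_exp.comp_aemeasurable ?_).ennreal_ofReal
    refine Finset.aemeasurable_fun_sum _ fun i _ => ?_
    refine AEMeasurable.mul (Measurable.aemeasurable ?_) (he i)
    fun_prop

/-- Markov's inequality at level `exp(2k)`, against the moment `√2 ^ k ≤ exp(k)`. -/
theorem measure_quadratic_ge_le {e : κ → Ω → ℝ} (hind : iIndepFun e μ) {c : ℝ≥0}
    (hsub : ∀ i, HasSubgaussianMGF (e i) c μ) (B : κ → ι → ℝ)
    (hB : ∀ z : ι → ℝ, c * ∑ i, (∑ j, B i j * z j) ^ 2 ≤ (∑ j, z j ^ 2) / 2) :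
    μ.real {ω | 4 * (Fintype.card ι : ℝ) ≤ ∑ j, (∑ i, B i j * e i ω) ^ 2} ≤
      Real.exp (-(Fintype.card ι : ℝ)) := by
  set k := Fintype.card ι with hk
  set f : Ω → ℝ≥0∞ := fun ω => ENNReal.ofReal (Real.exp ((∑ j, (∑ i, B i j * e i ω) ^ 2) / 2))
    with hf
  have hfm : AEMeasurable f μ := by
    refine (Real.measurable_exp.comp_aemeasurable ?_).ennreal_ofReal
    refine (Finset.aemeasurable_fun_sum _ fun j _ => ?_).div_const 2
    exact (Finset.aemeasurable_fun_sum _ fun i _ => (hsub i).aemeasurable.const_mul _).pow_const 2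
  have hmarkov := mul_meas_ge_le_lintegral₀ hfm (ENNReal.ofReal (Real.exp (2 * k)))
  have hset : {ω | 4 * (k : ℝ) ≤ ∑ j, (∑ i, B i j * e i ω) ^ 2} ⊆
      {ω | ENNReal.ofReal (Real.exp (2 * k)) ≤ f ω} := by
    intro ω hω
    simp only [Set.mem_ofPred_eq] at hω ⊢
    exact ENNReal.ofReal_le_ofReal (Real.exp_le_exp.2 (by linarith))
  have h₁ : ENNReal.ofReal (Real.exp (2 * k)) *
      μ {ω | 4 * (k : ℝ) ≤ ∑ j, (∑ i, B i j * e i ω) ^ 2} ≤ ENNReal.ofReal (√2 ^ k) :=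
    ((mul_le_mul_right (measure_mono hset) _).trans hmarkov).trans
      (lintegral_exp_quadratic_le hind hsub B hB)
  have h₂ := ENNReal.toReal_mono ENNReal.ofReal_ne_top h₁
  rw [ENNReal.toReal_mul, ENNReal.toReal_ofReal (Real.exp_pos _).le,
    ENNReal.toReal_ofReal (by positivity)] at h₂
  have h₃ : √2 ^ k ≤ Real.exp k := by
    rw [← mul_one (k : ℝ), Real.exp_nat_mul]
    refine pow_le_pow_left₀ (Real.sqrt_nonneg _) ?_ k
    have h₄ : √2 ≤ 2 := by rw [Real.sqrt_le_left (by norm_num)]; norm_num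
    linarith [Real.add_one_le_exp (1 : ℝ)]
  refine le_of_mul_le_mul_left ?_ (Real.exp_pos (2 * (k : ℝ)))
  rw [← Real.exp_add]
  refine (h₂.trans h₃).trans (Real.exp_le_exp.2 (by linarith))

theorem measure_abs_linear_ge_le {e : κ → Ω → ℝ} (hind : iIndepFun e μ) {c : ℝ≥0}
    (hsub : ∀ i, HasSubgaussianMGF (e i) c μ) (b : κ → ℝ) {t v : ℝ} (ht : 0 ≤ t) (hv : 0 < v)
    (hb : c * ∑ i, b i ^ 2 ≤ v) :
    μ.real {ω | t ≤ |∑ i, b i * e i ω|} ≤ 2 * Real.exp (-t ^ 2 / (2 * v)) := by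
  have h := hasSubgaussianMGF_linear hind hsub b (hb.trans (Real.le_coe_toNNReal v))
  have h₁ := h.measure_ge_le ht
  have h₂ := h.neg.measure_ge_le ht
  rw [Real.coe_toNNReal _ hv.le] at h₁ h₂
  have hset : {ω | t ≤ |∑ i, b i * e i ω|} ⊆ {ω | t ≤ ∑ i, b i * e i ω} ∪
      {ω | t ≤ (-fun ω => ∑ i, b i * e i ω) ω} := by
    intro ω hω
    simp only [Set.mem_ofPred_eq, le_abs, Set.mem_union, Pi.neg_apply] at hω ⊢
    exact hω
  linarith [measureReal_mono (μ := μ) hset, measureReal_union_le (μ := μ)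
    {ω | t ≤ ∑ i, b i * e i ω} {ω | t ≤ (-fun ω => ∑ i, b i * e i ω) ω}]

theorem measure_exists_abs_linear_ge_le {e : κ → Ω → ℝ} (hind : iIndepFun e μ) {c : ℝ≥0}
    (hsub : ∀ i, HasSubgaussianMGF (e i) c μ) (B : κ → ι → ℝ) {t v : ℝ} (ht : 0 ≤ t) (hv : 0 < v)
    (hb : ∀ j, c * ∑ i, B i j ^ 2 ≤ v) :
    μ.real {ω | ∃ j, t ≤ |∑ i, B i j * e i ω|} ≤
      2 * Fintype.card ι * Real.exp (-t ^ 2 / (2 * v)) := by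
  have hset : {ω | ∃ j, t ≤ |∑ i, B i j * e i ω|} = ⋃ j ∈ Finset.univ,
      {ω | t ≤ |∑ i, B i j * e i ω|} := by
    ext ω; simp
  rw [hset]
  refine (measureReal_biUnion_finset_le _ _).trans ?_
  refine (Finset.sum_le_card_nsmul _ _ _ fun j _ =>
    measure_abs_linear_ge_le hind hsub (fun i => B i j) ht hv (hb j)).trans (le_of_eq ?_)
  rw [nsmul_eq_mul, Finset.card_univ]
  ring

end Noise

/-! ### Derivatives of the quadratic loss. -/

section Loss

variable {n d : ℕ} (X : Matrix (Fin n) (Fin d) ℝ)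

/-- The design scaled by `n ^ (-1/2)`, whose Gram matrix is the Hessian of the loss. -/
noncomputable def scaledDesign : EuclideanSpace ℝ (Fin d) →ₗ[ℝ] EuclideanSpace ℝ (Fin n) :=
  (√(n : ℝ))⁻¹ • Matrix.toEuclideanLin X

/-- The gradient of the loss at the true parameter, for the noise `e`. -/
noncomputable def score (e : Fin n → ℝ) (j : Fin d) : ℝ := -((n : ℝ)⁻¹ * ∑ i, X i j * e i)

theorem norm_scaledDesign_sq (v : EuclideanSpace ℝ (Fin d)) :
    ‖scaledDesign X v‖ ^ 2 = (n : ℝ)⁻¹ * ‖Matrix.toEuclideanLin X v‖ ^ 2 := by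
  rw [scaledDesign, LinearMap.smul_apply, norm_smul, mul_pow, norm_inv, inv_pow,
    Real.norm_of_nonneg (Real.sqrt_nonneg _), Real.sq_sqrt (Nat.cast_nonneg n)]

/-- The derivative of the loss at a point with residual `-w`. -/
noncomputable def lossDeriv :
    EuclideanSpace ℝ (Fin n) →L[ℝ] EuclideanSpace ℝ (Fin d) →L[ℝ] ℝ :=
  (n : ℝ)⁻¹ • ((ContinuousLinearMap.compL ℝ (EuclideanSpace ℝ (Fin d)) (EuclideanSpace ℝ (Fin n))
    ℝ).flip (LinearMap.toContinuousLinearMap (Matrix.toEuclideanLin X))).comp (innerSL ℝ)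

theorem lossDeriv_apply (w : EuclideanSpace ℝ (Fin n)) (v : EuclideanSpace ℝ (Fin d)) :
    lossDeriv X w v = (n : ℝ)⁻¹ * inner ℝ w (Matrix.toEuclideanLin X v) := rfl

theorem hasFDerivAt_quadLoss (y : EuclideanSpace ℝ (Fin n)) (β : EuclideanSpace ℝ (Fin d)) :
    HasFDerivAt (quadLoss X y) (lossDeriv X (Matrix.toEuclideanLin X β - y)) β := by
  set XL := LinearMap.toContinuousLinearMap (Matrix.toEuclideanLin X)
  have h := ((XL.hasFDerivAt (x := β)).const_sub y).norm_sq.const_mul (2 * (n : ℝ))⁻¹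
  refine h.congr_fderiv ?_
  ext v
  rw [lossDeriv_apply, ← neg_sub y, inner_neg_left]
  simp only [smul_apply, ContinuousLinearMap.comp_apply,
    neg_apply, innerSL_apply_apply, inner_neg_right, smul_eq_mul, nsmul_eq_mul,
    mul_inv]
  have : XL v = Matrix.toEuclideanLin X v := rfl
  have h' : XL β = Matrix.toEuclideanLin X β := rfl
  rw [this, h']
  push_cast
  ring

theorem hessianForm_quadLoss (y : EuclideanSpace ℝ (Fin n)) (β v : EuclideanSpace ℝ (Fin d)) :
    hessianForm (quadLoss X y) β v = ‖scaledDesign X v‖ ^ 2 := by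
  have h₁ : fderiv ℝ (quadLoss X y) = fun β => lossDeriv X (Matrix.toEuclideanLin X β - y) :=
    funext fun β => (hasFDerivAt_quadLoss X y β).fderiv
  have h₂ := (lossDeriv X).hasFDerivAt.comp β
    (((LinearMap.toContinuousLinearMap (Matrix.toEuclideanLin X)).hasFDerivAt (x := β)).sub_const y)
  have h₃ : fderiv ℝ (fun β => lossDeriv X (Matrix.toEuclideanLin X β - y)) β = _ := h₂.fderiv
  rw [hessianForm, h₁, h₃, ContinuousLinearMap.comp_apply, lossDeriv_apply, norm_scaledDesign_sq,
    ← real_inner_self_eq_norm_sq]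
  rfl

theorem inner_toEuclideanLin (e : Fin n → ℝ) (v : EuclideanSpace ℝ (Fin d)) :
    (n : ℝ)⁻¹ * inner ℝ (WithLp.toLp 2 e) (Matrix.toEuclideanLin X v) =
      -∑ j, score X e j * v j := by
  simp only [PiLp.inner_apply, Matrix.toLpLin_apply, Matrix.mulVec, dotProduct, score,
    RCLike.inner_apply, conj_trivial, Finset.sum_mul, Finset.mul_sum, ← Finset.sum_neg_distrib, neg_mul, neg_neg]
  rw [Finset.sum_comm]
  exact Finset.sum_congr rfl fun j _ => Finset.sum_congr rfl fun i _ => by ring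

theorem sum_gradient_quadLoss_mul (βstar : EuclideanSpace ℝ (Fin d)) (e : Fin n → ℝ)
    (β : EuclideanSpace ℝ (Fin d)) :
    ∑ j, gradient (quadLoss X (response X βstar e)) β j * (β - βstar) j =
      ‖scaledDesign X (β - βstar)‖ ^ 2 + ∑ j, score X e j * (β - βstar) j := by
  set v := β - βstar with hv
  have h₁ : ∑ j, gradient (quadLoss X (response X βstar e)) β j * v j =
      inner ℝ (gradient (quadLoss X (response X βstar e)) β) v := by
    rw [PiLp.inner_apply]
    exact Finset.sum_congr rfl fun j _ => by simp [mul_comm]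
  rw [h₁, gradient, InnerProductSpace.toDual_symm_apply, (hasFDerivAt_quadLoss X _ β).fderiv,
    lossDeriv_apply, response, ← sub_sub, ← map_sub, ← hv, inner_sub_left, mul_sub,
    inner_toEuclideanLin X e, real_inner_self_eq_norm_sq, norm_scaledDesign_sq, sub_neg_eq_add]

end Loss

/-! ### Subgradients of the `ℓ¹` norm. -/

section Subgradient

variable {d : ℕ}

theorem sign_mem_subdifferential (β : EuclideanSpace ℝ (Fin d)) :
    (WithLp.toLp 2 fun j => (SignType.sign (β j) : ℝ)) ∈ subdifferential l1Norm β := by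
  intro x
  rw [l1Norm, l1Norm, ← Finset.sum_sub_distrib, PiLp.inner_apply]
  refine Finset.sum_le_sum fun j _ => ?_
  simp only [RCLike.inner_apply, conj_trivial, PiLp.sub_apply]
  rw [sub_mul, ← sign_mul_self (β j), mul_comm (β j)]
  have : x j * (SignType.sign (β j) : ℝ) ≤ |x j| := by
    rcases lt_trichotomy (β j) 0 with h | h | h
    · simpa [sign_neg h] using neg_le_abs (x j)
    · simp [h]
    · simpa [sign_pos h] using le_abs_self (x j)
  linarith

/-- Moving one coordinate reduces to the absolute value; the increments `±1` and `-β j` are enough.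
-/
theorem subgradient_l1Norm {β ξ : EuclideanSpace ℝ (Fin d)} (hξ : ξ ∈ subdifferential l1Norm β)
    (j : Fin d) : |ξ j| ≤ 1 ∧ ξ j * β j = |β j| := by
  have key : ∀ t : ℝ, ξ j * t ≤ |β j + t| - |β j| := by
    intro t
    have h := hξ (β + EuclideanSpace.single j t)
    rw [add_sub_cancel_left, EuclideanSpace.inner_single_right] at h
    have h₁ : l1Norm (β + EuclideanSpace.single j t) - l1Norm β = |β j + t| - |β j| := by
      rw [l1Norm, l1Norm, ← Finset.sum_sub_distrib]
      rw [Finset.sum_eq_single j]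
      · simp
      · intro k _ hk
        simp [hk]
      · simp
    rw [h₁] at h
    simpa [mul_comm] using h
  have habs : |ξ j| ≤ 1 := by
    have h₁ := key 1
    have h₂ := key (-1)
    have h₃ := abs_add_le (β j) 1
    have h₄ := abs_add_le (β j) (-1)
    rw [abs_neg] at h₄
    rw [abs_one] at h₃ h₄
    rw [abs_le]
    constructor <;> linarith
  refine ⟨habs, le_antisymm ?_ ?_⟩
  · calc ξ j * β j ≤ |ξ j * β j| := le_abs_self _
      _ = |ξ j| * |β j| := abs_mul _ _
      _ ≤ 1 * |β j| := by gcongr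
      _ = |β j| := one_mul _
  · have h := key (-β j)
    simp at h
    linarith

/-- The slack `ε < ε'` replaces attainment of the infimum. The sign vector rules out the infimum of
an empty set. -/
theorem IsEpsOptimal.exists_subgradient {L : EuclideanSpace ℝ (Fin d) → ℝ} {Λ : Fin d → ℝ}
    {ε ε' : ℝ} {β : EuclideanSpace ℝ (Fin d)} (h : IsEpsOptimal L Λ ε β) (hε : ε < ε') :
    ∃ ξ : Fin d → ℝ, (∀ j, |ξ j| ≤ 1 ∧ ξ j * β j = |β j|) ∧
      ∀ j, |gradient L β j + Λ j * ξ j| ≤ ε' := by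
  obtain ⟨_, ⟨ξ, hξ, rfl⟩, hlt⟩ := exists_lt_of_csInf_lt
    (Set.Nonempty.image _ ⟨_, sign_mem_subdifferential β⟩) (lt_of_le_of_lt h hε)
  exact ⟨ξ, subgradient_l1Norm hξ, fun j =>
    (norm_le_pi_norm (fun j => gradient L β j + Λ j * ξ j) j).trans hlt.le⟩

end Subgradient

/-! ### Sparse eigenvalues as bounds on the scaled design. -/

section SparseEigenvalues

variable {n d : ℕ} {X : Matrix (Fin n) (Fin d) ℝ}

theorem bddAbove_localizedSparseValues (y : EuclideanSpace ℝ (Fin n))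
    (βstar : EuclideanSpace ℝ (Fin d)) (m : ℕ) (r : ℝ) :
    BddAbove (localizedSparseValues (quadLoss X y) βstar m r) := by
  refine ⟨‖LinearMap.toContinuousLinearMap (scaledDesign X)‖ ^ 2, ?_⟩
  rintro _ ⟨J, u, β, hu, -, -, rfl⟩
  rw [hessianForm_quadLoss]
  have h := (LinearMap.toContinuousLinearMap (scaledDesign X)).le_opNorm (restrict J u)
  calc ‖scaledDesign X (restrict J u)‖ ^ 2
      ≤ (‖LinearMap.toContinuousLinearMap (scaledDesign X)‖ * ‖restrict J u‖) ^ 2 :=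
        pow_le_pow_left₀ (norm_nonneg _) h 2
    _ = _ := by rw [mul_pow, hu, mul_one]

theorem bddBelow_localizedSparseValues (y : EuclideanSpace ℝ (Fin n))
    (βstar : EuclideanSpace ℝ (Fin d)) (m : ℕ) (r : ℝ) :
    BddBelow (localizedSparseValues (quadLoss X y) βstar m r) := by
  refine ⟨0, ?_⟩
  rintro _ ⟨J, u, β, hu, -, -, rfl⟩
  rw [hessianForm_quadLoss]
  positivity

/-- The values at nonzero sparse directions, before normalization. -/
theorem div_mem_localizedSparseValues (y : EuclideanSpace ℝ (Fin n))
    {βstar : EuclideanSpace ℝ (Fin d)} {m : ℕ} {r : ℝ} (hr : 0 ≤ r) {J : Finset (Fin d)}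
    (hJ : J.card ≤ m) {u : EuclideanSpace ℝ (Fin d)} (hu : restrict J u ≠ 0) :
    ‖scaledDesign X (restrict J u)‖ ^ 2 / ‖restrict J u‖ ^ 2 ∈
      localizedSparseValues (quadLoss X y) βstar m r := by
  have hu' : ‖restrict J u‖ ≠ 0 := norm_ne_zero_iff.2 hu
  refine ⟨J, ‖restrict J u‖⁻¹ • u, βstar, ?_, hJ, by simpa using hr, ?_⟩
  · rw [restrict_smul, norm_smul, norm_inv, norm_norm, inv_mul_cancel₀ hu', one_pow]
  · rw [hessianForm_quadLoss, restrict_smul, map_smul, norm_smul, norm_inv, norm_norm, mul_pow,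
      inv_pow, div_eq_inv_mul]

theorem le_rhoPlus_mul (y : EuclideanSpace ℝ (Fin n))
    {βstar : EuclideanSpace ℝ (Fin d)} {m : ℕ} {r : ℝ} (hr : 0 ≤ r) {J : Finset (Fin d)}
    (hJ : J.card ≤ m) (u : EuclideanSpace ℝ (Fin d)) :
    ‖scaledDesign X (restrict J u)‖ ^ 2 ≤
      rhoPlus (quadLoss X y) βstar m r * ‖restrict J u‖ ^ 2 := by
  by_cases hu : restrict J u = 0
  · simp [hu]
  · have hpos : 0 < ‖restrict J u‖ ^ 2 := by positivity
    rw [← div_le_iff₀ hpos]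
    exact le_csSup (bddAbove_localizedSparseValues y βstar m r)
      (div_mem_localizedSparseValues y hr hJ hu)

theorem rhoMinus_mul_le (y : EuclideanSpace ℝ (Fin n))
    {βstar : EuclideanSpace ℝ (Fin d)} {m : ℕ} {r : ℝ} (hr : 0 ≤ r) {J : Finset (Fin d)}
    (hJ : J.card ≤ m) (u : EuclideanSpace ℝ (Fin d)) :
    rhoMinus (quadLoss X y) βstar m r * ‖restrict J u‖ ^ 2 ≤
      ‖scaledDesign X (restrict J u)‖ ^ 2 := by
  by_cases hu : restrict J u = 0
  · simp [hu]
  · have hpos : 0 < ‖restrict J u‖ ^ 2 := by positivity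
    rw [← le_div_iff₀ hpos]
    exact csInf_le (bddBelow_localizedSparseValues y βstar m r)
      (div_mem_localizedSparseValues y hr hJ hu)

theorem LSECondition.exists_bounds {y : EuclideanSpace ℝ (Fin n)}
    {βstar : EuclideanSpace ℝ (Fin d)} {ρlo ρhi : ℝ} (hs : 0 < (supp βstar).card)
    (h : LSECondition (quadLoss X y) βstar ρlo ρhi 2 (1 / 100)) :
    ∃ (m : ℕ) (ρ ρ' : ℝ), 2 * (supp βstar).card ≤ m ∧ ρlo ≤ ρ ∧
      (∀ J u, J.card ≤ 2 * (supp βstar).card + 2 * m →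
        ρ * ‖restrict J u‖ ^ 2 ≤ ‖scaledDesign X (restrict J u)‖ ^ 2) ∧
      (∀ J u, J.card ≤ m →
        ‖scaledDesign X (restrict J u)‖ ^ 2 ≤ ρ' * ‖restrict J u‖ ^ 2) ∧
      (∀ J u, J.card ≤ 2 * (supp βstar).card + 2 * m →
        ‖scaledDesign X (restrict J u)‖ ^ 2 ≤ ρhi * ‖restrict J u‖ ^ 2) ∧
      ρ' ≤ ρ * (1 + m / (100 * (supp βstar).card)) := by
  obtain ⟨m, r, hm, hpos, hlo, -, hhi, hratio⟩ := h
  -- A negative radius leaves no admissible `β`, and then `sInf ∅ = 0` contradicts `0 < ρlo`.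
  have hr : 0 ≤ r := by
    have hne : (localizedSparseValues (quadLoss X y) βstar
        (2 * (supp βstar).card + 2 * m) r).Nonempty := by
      by_contra hne
      rw [Set.not_nonempty_iff_eq_empty] at hne
      rw [rhoMinus, hne, Real.sInf_empty] at hlo
      linarith
    obtain ⟨_, J, u, β, -, -, hβ, -⟩ := hne
    exact (norm_nonneg _).trans hβ
  refine ⟨m, _, rhoPlus (quadLoss X y) βstar m r, by exact_mod_cast hm, hlo, fun J u hJ => rhoMinus_mul_le y hr hJ u,
    fun J u hJ => le_rhoPlus_mul y hr hJ u, fun J u hJ => ?_, ?_⟩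
  · exact (le_rhoPlus_mul y hr hJ u).trans (by gcongr)
  · rw [div_le_iff₀ (hpos.trans_le hlo)] at hratio
    refine hratio.trans (le_of_eq ?_)
    have : ((supp βstar).card : ℝ) ≠ 0 := by exact_mod_cast hs.ne'
    field_simp

end SparseEigenvalues

/-! ### Error bound for a single stage. -/

section Stage

variable {n d : ℕ} {X : Matrix (Fin n) (Fin d) ℝ} {βstar : EuclideanSpace ℝ (Fin d)}
  {e : Fin n → ℝ} {ρlo ρhi lam : ℝ}

theorem sqrt_sum_sq_le {ι : Type*} {E : Finset ι} {x : ι → ℝ} {c : ℝ} (hc : 0 ≤ c)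
    (hx : ∀ j ∈ E, |x j| ≤ c) : √(∑ j ∈ E, x j ^ 2) ≤ c * √E.card := by
  rw [Real.sqrt_le_left (by positivity), mul_pow, Real.sq_sqrt (Nat.cast_nonneg _)]
  refine (Finset.sum_le_card_nsmul E _ (c ^ 2) fun j hj => ?_).trans (le_of_eq ?_)
  · rw [← sq_abs]
    exact pow_le_pow_left₀ (abs_nonneg _) (hx j hj) 2
  · rw [nsmul_eq_mul, mul_comm]

theorem sum_abs_mul_abs_le {E : Finset (Fin d)} (x : Fin d → ℝ) (v : EuclideanSpace ℝ (Fin d)) :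
    ∑ j ∈ E, |x j| * |v j| ≤ √(∑ j ∈ E, x j ^ 2) * ‖restrict E v‖ := by
  rw [norm_restrict]
  simpa using Real.sum_mul_le_sqrt_mul_sqrt E (fun j => |x j|) (fun j => |v j|)

/-- The basic inequality for an approximate solution whose weights are large off `E`. -/
theorem basic_inequality {ε lam : ℝ} (hε : ε ≤ 3 / 16 * lam)
    (hg : ∀ j, |score X e j| ≤ lam / 16) {E : Finset (Fin d)} (hSE : supp βstar ⊆ E)
    {Λ : Fin d → ℝ} (hΛ₀ : ∀ j, 0 ≤ Λ j) (hΛ : ∀ j ∉ E, lam / 2 ≤ Λ j)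
    {β : EuclideanSpace ℝ (Fin d)} {ξ : Fin d → ℝ} (hξ : ∀ j, |ξ j| ≤ 1 ∧ ξ j * β j = |β j|)
    (hopt : ∀ j, |gradient (quadLoss X (response X βstar e)) β j + Λ j * ξ j| ≤ ε) :
    ‖scaledDesign X (β - βstar)‖ ^ 2 + lam / 4 * ∑ j ∈ Eᶜ, |(β - βstar) j| ≤
      (√(∑ j ∈ E, score X e j ^ 2) + ε * √E.card + √(∑ j ∈ supp βstar, Λ j ^ 2)) *
        ‖restrict E (β - βstar)‖ := by
  have hid := sum_gradient_quadLoss_mul X βstar e β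
  set v := β - βstar with hv
  set G := gradient (quadLoss X (response X βstar e)) β with hG
  have hterm : ∀ j, (G j - score X e j) * v j ≤
      (ε + |score X e j|) * |v j| - Λ j * (ξ j * v j) := by
    intro j
    have h₁ : (G j + Λ j * ξ j) * v j ≤ ε * |v j| := by
      refine (le_abs_self _).trans ?_
      rw [abs_mul]
      exact mul_le_mul_of_nonneg_right (hopt j) (abs_nonneg _)
    have h₂ : -(score X e j * v j) ≤ |score X e j| * |v j| := by
      rw [← abs_mul]
      exact neg_le_abs _
    linarith
  have hoffS : ∀ j ∉ supp βstar, ξ j * v j = |v j| := by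
    intro j hj
    have hz : βstar j = 0 := by simpa [supp] using hj
    have : v j = β j := by simp [hv, hz]
    rw [this, (hξ j).2]
  -- On `E \ S` the penalty term has the favourable sign and is dropped; on `S` the subgradient may
  -- have either sign.
  have hon : ∑ j ∈ E, (G j - score X e j) * v j ≤
      ∑ j ∈ E, |score X e j| * |v j| + ∑ j ∈ E, |ε| * |v j| +
        ∑ j ∈ supp βstar, |Λ j| * |v j| := by
    have hsplit : ∑ j ∈ supp βstar, |Λ j| * |v j| =
        ∑ j ∈ E, if j ∈ supp βstar then |Λ j| * |v j| else 0 := by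
      rw [Finset.sum_ite_mem, Finset.inter_eq_right.2 hSE]
    rw [hsplit, ← Finset.sum_add_distrib, ← Finset.sum_add_distrib]
    refine Finset.sum_le_sum fun j _ => ?_
    have h₀ := hterm j
    have h₁ : ε * |v j| ≤ |ε| * |v j| := mul_le_mul_of_nonneg_right (le_abs_self _) (abs_nonneg _)
    split_ifs with hj
    · have h₂ : -(Λ j * (ξ j * v j)) ≤ |Λ j| * |v j| := by
        calc -(Λ j * (ξ j * v j)) ≤ |Λ j * (ξ j * v j)| := neg_le_abs _
          _ = |Λ j| * (|ξ j| * |v j|) := by rw [abs_mul, abs_mul]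
          _ ≤ |Λ j| * (1 * |v j|) := by gcongr; exact (hξ j).1
          _ = |Λ j| * |v j| := by rw [one_mul]
      linarith
    · rw [hoffS j hj] at h₀
      have := mul_nonneg (hΛ₀ j) (abs_nonneg (v j))
      linarith
  -- The margin is `λ/2 - 3λ/16 - λ/16 = λ/4`.
  have hoff : ∑ j ∈ Eᶜ, (G j - score X e j) * v j ≤ -(lam / 4 * ∑ j ∈ Eᶜ, |v j|) := by
    rw [Finset.mul_sum, ← Finset.sum_neg_distrib]
    refine Finset.sum_le_sum fun j hj => ?_
    have hj' := Finset.mem_compl.1 hj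
    have h₀ := hterm j
    rw [hoffS j fun h => hj' (hSE h)] at h₀
    have h₁ := mul_le_mul_of_nonneg_right (hg j) (abs_nonneg (v j))
    have h₂ := mul_le_mul_of_nonneg_right hε (abs_nonneg (v j))
    have h₃ := mul_le_mul_of_nonneg_right (hΛ j hj') (abs_nonneg (v j))
    linarith
  have hε₀ : E.Nonempty → 0 ≤ ε := fun ⟨j, _⟩ => (abs_nonneg _).trans (hopt j)
  have hcs₁ := sum_abs_mul_abs_le (E := E) (score X e) v
  have hcs₂ : ∑ j ∈ E, |ε| * |v j| ≤ ε * √E.card * ‖restrict E v‖ := by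
    rcases E.eq_empty_or_nonempty with rfl | hne
    · simp
    · refine (sum_abs_mul_abs_le (fun _ => ε) v).trans ?_
      gcongr
      exact sqrt_sum_sq_le (hε₀ hne) fun _ _ => (abs_of_nonneg (hε₀ hne)).le
  have hcs₃ : ∑ j ∈ supp βstar, |Λ j| * |v j| ≤
      √(∑ j ∈ supp βstar, Λ j ^ 2) * ‖restrict E v‖ :=
    (sum_abs_mul_abs_le Λ v).trans (by gcongr; exact norm_restrict_mono hSE v)
  have hsum : ‖scaledDesign X v‖ ^ 2 = ∑ j ∈ E, (G j - score X e j) * v j +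
      ∑ j ∈ Eᶜ, (G j - score X e j) * v j := by
    rw [Finset.sum_add_sum_compl]
    simp only [sub_mul]
    rw [Finset.sum_sub_distrib, hid]
    ring
  rw [add_mul, add_mul]
  linarith

/-- The basic inequality serves twice: its `ℓ¹` term gives the cone, with constant `6 = 4 · 3/2`,
and its quadratic term gives `‖A v‖² ≤ a ‖v_E‖`. -/
theorem norm_sub_le_of_isEpsOptimal (hs : 0 < (supp βstar).card)
    (hL : LSECondition (quadLoss X (response X βstar e)) βstar ρlo ρhi 2 (1 / 100))
    (hlam : 0 < lam) (hg : ∀ j, |score X e j| ≤ lam / 16) {ε ε' : ℝ} (hε' : ε' < ε)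
    (hε : ε ≤ 3 / 16 * lam) {E : Finset (Fin d)} (hSE : supp βstar ⊆ E)
    (hE : E.card ≤ 2 * (supp βstar).card) {Λ : Fin d → ℝ} (hΛ₀ : ∀ j, 0 ≤ Λ j)
    (hΛ : ∀ j ∉ E, lam / 2 ≤ Λ j) {β : EuclideanSpace ℝ (Fin d)}
    (hopt : IsEpsOptimal (quadLoss X (response X βstar e)) Λ ε' β) {a : ℝ} (ha₀ : 0 ≤ a)
    (ha : √(∑ j ∈ E, score X e j ^ 2) + ε * √E.card + √(∑ j ∈ supp βstar, Λ j ^ 2) ≤ a)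
    (halam : a ≤ 3 / 2 * lam * √(supp βstar).card) : ρlo * ‖β - βstar‖ ≤ 9 * a := by
  obtain ⟨ξ, hξ, hres⟩ := hopt.exists_subgradient hε'
  have hρlo : 0 < ρlo := by
    obtain ⟨_, _, _, h, _⟩ := hL
    exact h
  obtain ⟨m, ρ, ρ', hm, hρ, hlo, hhi, -, hρ'⟩ := hL.exists_bounds hs
  have hbasic := basic_inequality hε hg hSE hΛ₀ hΛ hξ hres
  have hbasic' : ‖scaledDesign X (β - βstar)‖ ^ 2 + lam / 4 * ∑ j ∈ Eᶜ, |(β - βstar) j| ≤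
      a * ‖restrict E (β - βstar)‖ := hbasic.trans (by gcongr)
  have hl1 : 0 ≤ ∑ j ∈ Eᶜ, |(β - βstar) j| := Finset.sum_nonneg fun _ _ => abs_nonneg _
  have hcone : ∑ j ∈ Eᶜ, |(β - βstar) j| ≤
      6 * √(supp βstar).card * ‖restrict E (β - βstar)‖ := by
    have h₁ : a * ‖restrict E (β - βstar)‖ ≤
        3 / 2 * lam * √(supp βstar).card * ‖restrict E (β - βstar)‖ := by gcongr
    have h₂ := sq_nonneg ‖scaledDesign X (β - βstar)‖
    refine le_of_mul_le_mul_left ?_ (show 0 < lam / 4 by positivity)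
    linarith
  have hfin := norm_le_of_cone (scaledDesign X) hs hm (hρlo.trans_le hρ) hlo hhi hρ' hE hcone ha₀
    (by linarith [mul_nonneg (show 0 ≤ lam / 4 by positivity) hl1])
  exact (by gcongr : ρlo * ‖β - βstar‖ ≤ ρ * ‖β - βstar‖).trans hfin

theorem contraction_bound (hs : 0 < (supp βstar).card)
    (hL : LSECondition (quadLoss X (response X βstar e)) βstar ρlo ρhi 2 (1 / 100))
    (hlam : 0 < lam) (hg : ∀ j, |score X e j| ≤ lam / 16) {εc : ℝ} (hεc : εc ≤ lam / 8)
    {Λ : Fin d → ℝ} (hΛ : ∀ j, lam / 2 ≤ Λ j) (hΛ' : ∀ j, Λ j ≤ lam)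
    {β : EuclideanSpace ℝ (Fin d)}
    (hopt : IsEpsOptimal (quadLoss X (response X βstar e)) Λ εc β) :
    ρlo * ‖β - βstar‖ ≤ 18 * lam * √(supp βstar).card := by
  have hΛ₀ : ∀ j, 0 ≤ Λ j := fun j => (by positivity : 0 ≤ lam / 2).trans (hΛ j)
  have h₁ := sqrt_sum_sq_le (E := supp βstar) (by positivity : 0 ≤ lam / 16) fun j _ => hg j
  have h₂ := sqrt_sum_sq_le (E := supp βstar) (x := Λ) hlam.le fun j _ => by
    rw [abs_of_nonneg (hΛ₀ j)]; exact hΛ' j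
  have hpos : 0 ≤ lam * √(supp βstar).card := by positivity
  -- Score, tolerance and weights add up to `1/16 + 3/16 + 1 = 5/4`.
  have h := norm_sub_le_of_isEpsOptimal hs hL hlam hg (ε := 3 / 16 * lam) (by linarith) le_rfl
    subset_rfl (by omega) hΛ₀ (fun j _ => hΛ j) hopt (a := 5 / 4 * lam * √(supp βstar).card)
    (by positivity) (by linarith) (by linarith)
  linarith

/-- The first conclusion reproduces the hypothesis on `β`, so that stages can be iterated; the
second is the contraction. Only `δ⁻¹ ≥ 1` matters, so the factor 3/4 serves every `δ`. -/
theorem tightening_bound (hs : 0 < (supp βstar).card)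
    (hL : LSECondition (quadLoss X (response X βstar e)) βstar ρlo ρhi 2 (1 / 100))
    (hlam : 0 < lam) (hg : ∀ j, |score X e j| ≤ lam / 16) {w : ℝ → ℝ}
    (hw : IsTighteningFunction w) {δ γ : ℝ} (hδ : 0 < δ) (hδ' : δ < 1)
    (hwu : 1 / 2 ≤ w (18 * ρlo⁻¹ * δ⁻¹ * lam)) (hγ : 0 < γ)
    (hsignal : ∀ j ∈ supp βstar, 18 * ρlo⁻¹ * δ⁻¹ * lam + γ * lam ≤ |βstar j|)
    (hwγ : w (γ * lam) = 0) {εt η : ℝ} (hεt : εt < η) (hη₀ : 0 ≤ η) (hη : η ≤ 3 / 16 * lam)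
    {β β' : EuclideanSpace ℝ (Fin d)}
    (hβ : ρlo * ‖β - βstar‖ ≤ 18 * lam * √(supp βstar).card)
    (hopt : IsEpsOptimal (quadLoss X (response X βstar e)) (adaptiveWeights lam w β) εt β') :
    ρlo * ‖β' - βstar‖ ≤ 18 * lam * √(supp βstar).card ∧
      ρlo * ‖β' - βstar‖ ≤ 9 * (√(∑ j ∈ supp βstar, score X e j ^ 2) +
        3 / 2 * η * √(supp βstar).card) + 3 / 4 * (ρlo * ‖β - βstar‖) := by
  have hρlo : 0 < ρlo := by
    obtain ⟨_, _, _, h, _⟩ := hL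
    exact h
  set S := supp βstar with hS
  set u := 18 * ρlo⁻¹ * δ⁻¹ * lam with hu
  set v := β - βstar with hv
  have hu₀ : 0 < u := by positivity
  have hs' : (0 : ℝ) < S.card := by exact_mod_cast hs
  set F := Finset.univ.filter fun j => j ∉ S ∧ u < |β j| with hF
  set Λ := adaptiveWeights lam w β with hΛdef
  have hSF : Disjoint S F := Finset.disjoint_left.2 fun j h₁ h₂ => (Finset.mem_filter.1 h₂).2.1 h₁
  have hΛ₀ : ∀ j, 0 ≤ Λ j := fun j => mul_nonneg hlam.le (hw.nonneg _ (abs_nonneg _))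
  have hΛ₁ : ∀ j, Λ j ≤ lam := fun j => by
    have := mul_le_mul_of_nonneg_left (hw.le_one _ (abs_nonneg (β j))) hlam.le
    simpa [hΛdef, adaptiveWeights] using this
  have hΛE : ∀ j ∉ S ∪ F, lam / 2 ≤ Λ j := by
    intro j hj
    have hj' : |β j| ≤ u := by
      by_contra hlt
      apply hj
      rw [Finset.mem_union]
      by_cases hjS : j ∈ S
      · exact Or.inl hjS
      · exact Or.inr (Finset.mem_filter.2 ⟨Finset.mem_univ _, hjS, not_le.1 hlt⟩)
    have h₁ := hw.antitone u |β j| (abs_nonneg _) hj'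
    have h₂ := mul_le_mul_of_nonneg_left (hwu.trans h₁) hlam.le
    have h₃ : Λ j = lam * w |β j| := rfl
    linarith
  -- the false discoveries of the previous stage
  have hFsq : u ^ 2 * F.card ≤ ‖v‖ ^ 2 := by
    calc u ^ 2 * F.card = F.card • u ^ 2 := by rw [nsmul_eq_mul, mul_comm]
      _ ≤ ∑ j ∈ F, v j ^ 2 := Finset.card_nsmul_le_sum _ _ _ fun j hj => by
        obtain ⟨-, hjS, hju⟩ := Finset.mem_filter.1 hj
        have hz : βstar j = 0 := by simpa [hS, supp] using hjS
        have : v j = β j := by simp [hv, hz]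
        rw [this, ← sq_abs (β j)]
        exact pow_le_pow_left₀ hu₀.le hju.le 2
      _ ≤ ‖v‖ ^ 2 := by
        rw [← norm_restrict_sq]
        exact pow_le_pow_left₀ (norm_nonneg _) (norm_restrict_le _ _) 2
  have hFsqrt : u * √F.card ≤ ‖v‖ := by
    apply le_of_sq_le_sq _ (norm_nonneg _)
    rwa [mul_pow, Real.sq_sqrt (Nat.cast_nonneg _)]
  have hρu : ρlo * u = 18 * δ⁻¹ * lam := by
    rw [hu]
    field_simp
  have hδinv : 1 ≤ δ⁻¹ := (one_le_inv₀ hδ).2 hδ'.le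
  have hlamu : 18 * lam ≤ ρlo * u := by
    rw [hρu]
    nlinarith
  -- The 18 in `u` matches the 18 in the crude bound on `β`: more than `s` errors above `u` would
  -- exceed that bound.
  have hFS : F.card ≤ S.card := by
    have h₁ : 18 * lam * √F.card ≤ 18 * lam * √S.card := by
      calc 18 * lam * √F.card ≤ ρlo * u * √F.card := by gcongr
        _ = ρlo * (u * √F.card) := by ring
        _ ≤ ρlo * ‖v‖ := by gcongr
        _ ≤ _ := hβ
    have h₂ := le_of_mul_le_mul_left h₁ (by positivity)
    rw [Real.sqrt_le_sqrt_iff hs'.le] at h₂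
    exact_mod_cast h₂
  have hcard : (S ∪ F).card ≤ 2 * S.card := (Finset.card_union_le _ _).trans (by omega)
  have hsqrtcard : √((S ∪ F).card : ℝ) ≤ 3 / 2 * √S.card := by
    rw [Real.sqrt_le_left (by positivity), mul_pow, Real.sq_sqrt hs'.le]
    have : ((S ∪ F).card : ℝ) ≤ 2 * S.card := by exact_mod_cast hcard
    linarith
  -- the weights on the support
  have hΛS : 18 * √(∑ j ∈ S, Λ j ^ 2) ≤ ρlo * ‖v‖ := by
    have hj : ∀ j ∈ S, Λ j ^ 2 * u ^ 2 ≤ lam ^ 2 * v j ^ 2 := by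
      intro j hj
      rw [← mul_pow, ← sq_abs (v j), ← mul_pow]
      apply pow_le_pow_left₀ (mul_nonneg (hΛ₀ j) hu₀.le)
      rcases le_or_gt (γ * lam) |β j| with hle | hlt
      · have h₁ := hw.antitone |β j| (γ * lam) (by positivity) hle
        have h₂ : w |β j| = 0 := le_antisymm (hwγ ▸ h₁) (hw.nonneg _ (abs_nonneg _))
        have h₃ : Λ j = 0 := by rw [hΛdef, adaptiveWeights, h₂, mul_zero]
        rw [h₃, zero_mul]
        positivity
      -- A weight that may survive on the support means `|β j| < γλ`, whereas `|β* j| ≥ u + γλ`; the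
      -- error there is at least `u`.
      · have h₁ := hsignal j hj
        have h₂ : |βstar j| - |β j| ≤ |v j| := by
          rw [hv, PiLp.sub_apply, abs_sub_comm]
          exact abs_sub_abs_le_abs_sub _ _
        exact mul_le_mul (hΛ₁ j) (by linarith) hu₀.le hlam.le
    have h₁ : √(∑ j ∈ S, Λ j ^ 2) * u ≤ lam * ‖v‖ := by
      apply le_of_sq_le_sq _ (by positivity)
      rw [mul_pow _ u, Real.sq_sqrt (Finset.sum_nonneg fun _ _ => sq_nonneg _), Finset.sum_mul]
      refine (Finset.sum_le_sum hj).trans ?_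
      rw [← Finset.mul_sum, ← norm_restrict_sq, mul_pow]
      gcongr
      exact norm_restrict_le _ _
    refine le_of_mul_le_mul_left ?_ hlam
    calc lam * (18 * √(∑ j ∈ S, Λ j ^ 2)) = 18 * lam * √(∑ j ∈ S, Λ j ^ 2) := by ring
      _ ≤ ρlo * u * √(∑ j ∈ S, Λ j ^ 2) := by gcongr
      _ = ρlo * (√(∑ j ∈ S, Λ j ^ 2) * u) := by ring
      _ ≤ ρlo * (lam * ‖v‖) := by gcongr
      _ = lam * (ρlo * ‖v‖) := by ring
  have hgE : √(∑ j ∈ S ∪ F, score X e j ^ 2) ≤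
      √(∑ j ∈ S, score X e j ^ 2) + lam / 16 * √F.card := by
    rw [Finset.sum_union hSF]
    have h₁ := sqrt_sum_sq_le (E := F) (by positivity : 0 ≤ lam / 16) fun j _ => hg j
    refine (Real.sqrt_le_left (by positivity)).2 ?_
    have h₂ := Real.sq_sqrt (Finset.sum_nonneg fun j (_ : j ∈ S) => sq_nonneg (score X e j))
    have h₃ := Real.sq_sqrt (Finset.sum_nonneg fun j (_ : j ∈ F) => sq_nonneg (score X e j))
    have h₄ := Real.sqrt_nonneg (∑ j ∈ S, score X e j ^ 2)
    have h₅ := pow_le_pow_left₀ (Real.sqrt_nonneg _) h₁ 2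
    have h₆ := mul_nonneg h₄ (by positivity : 0 ≤ lam / 16 * √F.card)
    linarith [add_sq (√(∑ j ∈ S, score X e j ^ 2)) (lam / 16 * √F.card)]
  have hlamF : 18 * (lam * √F.card) ≤ ρlo * ‖v‖ := by
    calc 18 * (lam * √F.card) = 18 * lam * √F.card := by ring
      _ ≤ ρlo * u * √F.card := by gcongr
      _ = ρlo * (u * √F.card) := by ring
      _ ≤ ρlo * ‖v‖ := by gcongr
  have hηE : η * √((S ∪ F).card : ℝ) ≤ 3 / 2 * η * √S.card := by
    calc η * √((S ∪ F).card : ℝ) ≤ η * (3 / 2 * √S.card) := by gcongr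
      _ = _ := by ring
  set a := √(∑ j ∈ S ∪ F, score X e j ^ 2) + η * √((S ∪ F).card : ℝ) +
    √(∑ j ∈ S, Λ j ^ 2) with ha
  have ha₀ : 0 ≤ a := by positivity
  have halam : a ≤ 3 / 2 * lam * √S.card := by
    have h₁ := sqrt_sum_sq_le (E := S ∪ F) (by positivity : 0 ≤ lam / 16) fun j _ => hg j
    have h₂ := sqrt_sum_sq_le (E := S) (x := Λ) hlam.le fun j _ => by
      rw [abs_of_nonneg (hΛ₀ j)]; exact hΛ₁ j
    have h₃ : η * √((S ∪ F).card : ℝ) ≤ 3 / 16 * lam * √((S ∪ F).card : ℝ) := by gcongr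
    have h₄ : lam * √((S ∪ F).card : ℝ) ≤ lam * (3 / 2 * √S.card) := by gcongr
    have h₅ : 0 ≤ lam * √S.card := by positivity
    linarith
  have h := norm_sub_le_of_isEpsOptimal hs hL hlam hg hεt hη Finset.subset_union_left hcard hΛ₀ hΛE
    hopt ha₀ le_rfl halam
  constructor
  · linarith [(by positivity : 0 ≤ lam * √S.card)]
  -- Weights on `S` and score on `F` contribute `9(1/18 + 1/288) = 17/32 ≤ 3/4` of the previous
  -- error.
  · have h₀ : 0 ≤ ρlo * ‖v‖ := by positivity
    linarith

end Stage

/-! ### Iteration of the stages. -/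

section Sequence

variable {n d : ℕ} {X : Matrix (Fin n) (Fin d) ℝ} {βstar : EuclideanSpace ℝ (Fin d)}
  {e : Fin n → ℝ} {ρlo ρhi lam : ℝ}

/-- The recursion `x ↦ 9N + 3x/4` has fixed point `36N`. The constant 24 makes stage 1 start from
`18 = (3/4) · 24`. -/
theorem IsTACSequence.norm_sub_le (hs : 0 < (supp βstar).card)
    (hL : LSECondition (quadLoss X (response X βstar e)) βstar ρlo ρhi 2 (1 / 100))
    (hlam : 0 < lam) (hg : ∀ j, |score X e j| ≤ lam / 16) {w : ℝ → ℝ}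
    (hw : IsTighteningFunction w) {δ γ : ℝ} (hδ : 0 < δ) (hδ' : δ < 1)
    (hwu : 1 / 2 ≤ w (18 * ρlo⁻¹ * δ⁻¹ * lam)) (hγ : 0 < γ)
    (hsignal : ∀ j ∈ supp βstar, 18 * ρlo⁻¹ * δ⁻¹ * lam + γ * lam ≤ |βstar j|)
    (hwγ : w (γ * lam) = 0) {εc εt η : ℝ} (hεc : εc ≤ lam / 8) (hεt : εt < η) (hη₀ : 0 ≤ η)
    (hη : η ≤ 3 / 16 * lam) {Λ₀ : Fin d → ℝ} (hΛ : ∀ j, lam / 2 ≤ Λ₀ j) (hΛ' : ∀ j, Λ₀ j ≤ lam)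
    {T : ℕ} {b : ℕ → EuclideanSpace ℝ (Fin d)}
    (hb : IsTACSequence (quadLoss X (response X βstar e)) lam w Λ₀ εc εt T b) (hT : 1 ≤ T) :
    ρlo * ‖b T - βstar‖ ≤ (3 / 4) ^ T * (24 * lam * √(supp βstar).card) +
      36 * (√(∑ j ∈ supp βstar, score X e j ^ 2) + 3 / 2 * η * √(supp βstar).card) := by
  set N := √(∑ j ∈ supp βstar, score X e j ^ 2) + 3 / 2 * η * √(supp βstar).card with hN
  have hN₀ : 0 ≤ N := by positivity
  have key : ∀ ℓ : ℕ, 1 ≤ ℓ → ℓ ≤ T →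
      ρlo * ‖b ℓ - βstar‖ ≤ 18 * lam * √(supp βstar).card ∧
      ρlo * ‖b ℓ - βstar‖ ≤ (3 / 4) ^ ℓ * (24 * lam * √(supp βstar).card) + 36 * N := by
    intro ℓ hℓ
    induction ℓ, hℓ using Nat.le_induction with
    | base =>
      intro _
      have h := contraction_bound hs hL hlam hg hεc hΛ hΛ' hb.contraction
      exact ⟨h, by linarith⟩
    | succ ℓ hℓ ih =>
      intro hℓT
      obtain ⟨h₁, h₂⟩ := ih (by omega)
      obtain ⟨h₃, h₄⟩ := tightening_bound hs hL hlam hg hw hδ hδ' hwu hγ hsignal hwγ hεt hη₀ hη h₁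
        (hb.tightening ℓ hℓ (by omega))
      refine ⟨h₃, ?_⟩
      rw [pow_succ]
      linarith
  exact (key T hT le_rfl).2

end Sequence

/-! ### Probability of the noise events, and the number of stages. -/

section Events

variable {n d : ℕ} {X : Matrix (Fin n) (Fin d) ℝ} {βstar : EuclideanSpace ℝ (Fin d)}
  {Ω : Type*} [MeasurableSpace Ω] {μ : Measure Ω} [IsProbabilityMeasure μ]
  {e : Fin n → Ω → ℝ} {σ : NNReal}

theorem measure_score_large_le (hn : 1 ≤ n) (hd : 2 ≤ d) (hσ : 0 < σ) (hind : iIndepFun e μ)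
    (hsub : ∀ i, HasSubgaussianMGF (e i) (σ ^ 2) μ)
    (hX : ∀ j, ‖(WithLp.toLp 2 (fun i => X i j) : EuclideanSpace ℝ (Fin n))‖ ≤ √(n : ℝ))
    {lam : ℝ} (hlam : 32 * σ * √(Real.log d / n) ≤ lam) :
    μ.real {ω | ∃ j, lam / 16 ≤ |score X (fun i => e i ω) j|} ≤ 2 * (d : ℝ) ^ (-1 : ℝ) := by
  have hn' : (0 : ℝ) < n := by exact_mod_cast hn
  have hd' : (0 : ℝ) < d := by exact_mod_cast (by omega : 0 < d)
  have hσ' : (0 : ℝ) < σ := hσ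
  have hlog : 0 ≤ Real.log d := Real.log_natCast_nonneg d
  have hlam₀ : 0 ≤ lam := le_trans (by positivity) hlam
  have hcol : ∀ j, ((σ ^ 2 : NNReal) : ℝ) * ∑ i, ((n : ℝ)⁻¹ * X i j) ^ 2 ≤ σ ^ 2 / n := by
    intro j
    have h := pow_le_pow_left₀ (norm_nonneg _) (hX j) 2
    rw [Real.sq_sqrt hn'.le, EuclideanSpace.real_norm_sq_eq] at h
    simp only [mul_pow, ← Finset.mul_sum]
    push_cast
    calc (σ : ℝ) ^ 2 * ((n : ℝ)⁻¹ ^ 2 * ∑ i, X i j ^ 2)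
        ≤ (σ : ℝ) ^ 2 * ((n : ℝ)⁻¹ ^ 2 * n) := by gcongr
      _ = (σ : ℝ) ^ 2 / n := by field_simp
  have h := measure_exists_abs_linear_ge_le hind hsub (fun i j => (n : ℝ)⁻¹ * X i j)
    (t := lam / 16) (by positivity) (v := σ ^ 2 / n) (by positivity) hcol
  have hset : {ω | ∃ j, lam / 16 ≤ |score X (fun i => e i ω) j|} =
      {ω | ∃ j, lam / 16 ≤ |∑ i, (n : ℝ)⁻¹ * X i j * e i ω|} := by
    simp only [score, abs_neg, Finset.mul_sum, mul_assoc]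
  rw [hset]
  refine h.trans ?_
  have hsq : 1024 * σ ^ 2 * Real.log d ≤ n * lam ^ 2 := by
    have h₁ := pow_le_pow_left₀ (by positivity) hlam 2
    rw [mul_pow, Real.sq_sqrt (by positivity)] at h₁
    calc 1024 * (σ : ℝ) ^ 2 * Real.log d = n * ((32 * σ) ^ 2 * (Real.log d / n)) := by
          field_simp
          ring
      _ ≤ n * lam ^ 2 := by gcongr
  -- The 32 is chosen to reach `d⁻²` per coordinate, leaving `d⁻¹` after the union bound.
  have hexp : Real.exp (-(lam / 16) ^ 2 / (2 * (σ ^ 2 / n))) ≤ Real.exp (-(2 * Real.log d)) := by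
    apply Real.exp_le_exp.2
    rw [neg_div, neg_le_neg_iff, le_div_iff₀ (by positivity)]
    calc 2 * Real.log d * (2 * (σ ^ 2 / n)) = 1024 * σ ^ 2 * Real.log d / (256 * n) := by
          field_simp
          ring
      _ ≤ n * lam ^ 2 / (256 * n) := by gcongr
      _ = (lam / 16) ^ 2 := by
        field_simp
        ring
  have hval : Real.exp (-(2 * Real.log d)) = (d : ℝ)⁻¹ * (d : ℝ)⁻¹ := by
    rw [two_mul, neg_add, Real.exp_add, Real.exp_neg, Real.exp_log hd']
  rw [Fintype.card_fin, Real.rpow_neg_one]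
  calc 2 * (d : ℝ) * Real.exp (-(lam / 16) ^ 2 / (2 * (σ ^ 2 / n)))
      ≤ 2 * (d : ℝ) * ((d : ℝ)⁻¹ * (d : ℝ)⁻¹) := by
        rw [← hval]
        gcongr
    _ = 2 * (d : ℝ)⁻¹ := by field_simp

theorem measure_score_supp_large_le (hn : 1 ≤ n) (hσ : 0 < σ) (hind : iIndepFun e μ)
    (hsub : ∀ i, HasSubgaussianMGF (e i) (σ ^ 2) μ) {ρhi : ℝ} (hρhi : 0 < ρhi)
    (S : Finset (Fin d))
    (hS : ∀ u, ‖scaledDesign X (restrict S u)‖ ^ 2 ≤ ρhi * ‖restrict S u‖ ^ 2) :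
    μ.real {ω | 8 * σ ^ 2 * ρhi * (S.card / n) ≤ ∑ j ∈ S, score X (fun i => e i ω) j ^ 2} ≤
      Real.exp (-(S.card : ℝ)) := by
  have hn' : (0 : ℝ) < n := by exact_mod_cast hn
  have hσ' : (0 : ℝ) < σ := hσ
  -- This scaling makes the upper eigenvalue bound on `S` exactly the hypothesis `hB` of
  -- `measure_quadratic_ge_le`.
  set α := √(n / (2 * σ ^ 2 * ρhi)) with hα
  have hα₂ : α ^ 2 = n / (2 * σ ^ 2 * ρhi) := Real.sq_sqrt (by positivity)
  have hB : ∀ z : S → ℝ, ((σ ^ 2 : NNReal) : ℝ) *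
      ∑ i, (∑ j : S, α * (n : ℝ)⁻¹ * X i j * z j) ^ 2 ≤ (∑ j, z j ^ 2) / 2 := by
    intro z
    set u : EuclideanSpace ℝ (Fin d) :=
      WithLp.toLp 2 fun j => if h : j ∈ S then z ⟨j, h⟩ else 0 with hu
    have huz : ∀ j : S, u j = z j := fun j => by simp [hu]
    have h := hS u
    rw [norm_restrict_sq, norm_scaledDesign_sq, EuclideanSpace.real_norm_sq_eq] at h
    have h₁ : ∑ j ∈ S, u j ^ 2 = ∑ j, z j ^ 2 := by
      rw [← Finset.sum_coe_sort S]
      exact Finset.sum_congr rfl fun j _ => by rw [huz]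
    have h₂ : ∀ i, Matrix.toEuclideanLin X (restrict S u) i = ∑ j : S, X i j * z j := by
      intro i
      have : Matrix.toEuclideanLin X (restrict S u) i = ∑ j, X i j * restrict S u j := rfl
      rw [this]
      simp only [restrict_apply, mul_ite, mul_zero, Finset.sum_ite_mem, Finset.univ_inter]
      rw [← Finset.sum_coe_sort S]
      exact Finset.sum_congr rfl fun j _ => by rw [huz]
    rw [h₁] at h
    simp only [h₂] at h
    have h₃ : ∀ i, (∑ j : S, α * (n : ℝ)⁻¹ * X i j * z j) ^ 2 =
        α ^ 2 * (n : ℝ)⁻¹ * ((n : ℝ)⁻¹ * (∑ j : S, X i j * z j) ^ 2) := by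
      intro i
      simp only [mul_assoc, ← Finset.mul_sum]
      ring
    simp only [h₃, ← Finset.mul_sum]
    push_cast
    rw [hα₂]
    calc (σ : ℝ) ^ 2 * (n / (2 * σ ^ 2 * ρhi) * (n : ℝ)⁻¹ *
          ((n : ℝ)⁻¹ * ∑ i, (∑ j : S, X i j * z j) ^ 2))
        ≤ (σ : ℝ) ^ 2 * (n / (2 * σ ^ 2 * ρhi) * (n : ℝ)⁻¹ * (ρhi * ∑ j, z j ^ 2)) := by gcongr
      _ = (∑ j, z j ^ 2) / 2 := by field_simp
  have h := measure_quadratic_ge_le hind hsub (fun i (j : S) => α * (n : ℝ)⁻¹ * X i j) hB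
  rw [Fintype.card_coe] at h
  refine (measureReal_mono fun ω hω => ?_).trans h
  simp only [Set.mem_ofPred_eq] at hω ⊢
  have hsum : ∑ j : S, (∑ i, α * (n : ℝ)⁻¹ * X i j * e i ω) ^ 2 =
      α ^ 2 * ∑ j ∈ S, score X (fun i => e i ω) j ^ 2 := by
    rw [← Finset.sum_coe_sort S, Finset.mul_sum]
    refine Finset.sum_congr rfl fun j _ => ?_
    simp only [score, mul_assoc, ← Finset.mul_sum]
    ring
  rw [hsum, hα₂]
  calc 4 * (S.card : ℝ) = n / (2 * σ ^ 2 * ρhi) * (8 * σ ^ 2 * ρhi * (S.card / n)) := by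
        field_simp
        ring
    _ ≤ _ := by gcongr

/-- From `3/4 ≤ exp(-1/4)`, the power is at most `exp(-T/4) ≤ (log d)^(-1/2)`. -/
theorem pow_mul_sqrt_log_le_one (hd : 2 ≤ d) {T : ℕ} (hT : 2 * Real.log (Real.log d) ≤ T) :
    (3 / 4 : ℝ) ^ T * √(Real.log d) ≤ 1 := by
  have hlog : 0 < Real.log d := Real.log_pos (by exact_mod_cast (by omega : 1 < d))
  have h₁ : (3 / 4 : ℝ) ^ T ≤ Real.exp (-(T / 4 : ℝ)) := by
    have : Real.exp (-(T / 4 : ℝ)) = Real.exp (-(1 / 4)) ^ T := by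
      rw [← Real.exp_nat_mul]
      congr 1
      ring
    rw [this]
    refine pow_le_pow_left₀ (by norm_num) ?_ T
    linarith [Real.add_one_le_exp (-(1 / 4) : ℝ)]
  have h₂ : √(Real.log d) = Real.exp (Real.log (Real.log d) / 2) := by
    rw [Real.sqrt_eq_iff_mul_self_eq hlog.le (Real.exp_pos _).le, ← Real.exp_add, add_halves,
      Real.exp_log hlog]
  calc (3 / 4 : ℝ) ^ T * √(Real.log d)
      ≤ Real.exp (-(T / 4 : ℝ)) * Real.exp (Real.log (Real.log d) / 2) := by
        rw [h₂]
        gcongr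
    _ = Real.exp (-(T / 4 : ℝ) + Real.log (Real.log d) / 2) := (Real.exp_add _ _).symm
    _ ≤ 1 := by
      rw [Real.exp_le_one_iff]
      linarith

end Events

end ILAMM

/-! ### Choice of constants and assembly. -/

theorem corollary4p3 :
    ∀ δ : ℝ, 0 < δ → δ < 1 → ∃ cT : ℝ, 0 < cT ∧
    ∀ σ : NNReal, 0 < σ → ∃ c₀ : ℝ, 0 < c₀ ∧
    ∀ c₁ c₂ ρlo ρhi : ℝ, c₀ ≤ c₁ → c₁ ≤ c₂ → 0 < ρlo → ρlo ≤ ρhi →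
    ∃ η₁ η₂ K : ℝ, 0 < η₁ ∧ 0 < η₂ ∧ 0 < K ∧
    ∀ (n d : ℕ), 1 ≤ n → 2 ≤ d →
    ∀ (X : Matrix (Fin n) (Fin d) ℝ) (βstar : EuclideanSpace ℝ (Fin d))
      (Ω : Type*) [MeasurableSpace Ω] (μ : Measure Ω) [IsProbabilityMeasure μ]
      (e : Fin n → Ω → ℝ) (w : ℝ → ℝ) (lam γ εc εt : ℝ) (Λ₀ : Fin d → ℝ) (T : ℕ),
    -- i.i.d. centred sub-Gaussian noise with variance proxy `σ²`
    iIndepFun e μ →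
    (∀ i k, IdentDistrib (e i) (e k) μ μ) →
    (∀ i, HasSubgaussianMGF (e i) (σ ^ 2) μ) →
    -- column normalization
    (∀ j, ‖(WithLp.toLp 2 (fun i => X i j) : EuclideanSpace ℝ (Fin n))‖ ≤ √(n : ℝ)) →
    -- localized sparse eigenvalues (the Hessian of the quadratic loss does not depend on `ω`)
    (∀ ω, ILAMM.LSECondition
      (ILAMM.quadLoss X (ILAMM.response X βstar (fun i => e i ω))) βstar ρlo ρhi 2 (1 / 100)) →
    -- tightening function, with `u = 18 ρ_*⁻¹ δ⁻¹ λ`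
    ILAMM.IsTighteningFunction w →
    1 / 2 ≤ w (18 * ρlo⁻¹ * δ⁻¹ * lam) →
    -- minimal signal strength
    0 < γ →
    (∀ j ∈ ILAMM.supp βstar, 18 * ρlo⁻¹ * δ⁻¹ * lam + γ * lam ≤ |βstar j|) →
    w (γ * lam) = 0 →
    -- tuning parameters
    c₁ * √(Real.log d / n) ≤ lam → lam ≤ c₂ * √(Real.log d / n) →
    εc ≤ lam / 8 → εt ≤ √(1 / (n : ℝ)) →
    1 ≤ T → cT * Real.log (Real.log d) ≤ T →
    -- contraction-stage weights `λ𝟏`, or `λ w(0) 𝟏` from the initial value `0`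
    (Λ₀ = (fun _ => lam) ∨ Λ₀ = ILAMM.adaptiveWeights lam w (0 : EuclideanSpace ℝ (Fin d))) →
    ∃ A : Set Ω, MeasurableSet A ∧
      1 - 2 * (d : ℝ) ^ (-η₁) - 2 * Real.exp (-η₂ * ((ILAMM.supp βstar).card : ℝ)) ≤ μ.real A ∧
      ∀ ω ∈ A, ∀ b : ℕ → EuclideanSpace ℝ (Fin d),
        ILAMM.IsTACSequence (ILAMM.quadLoss X (ILAMM.response X βstar (fun i => e i ω)))
          lam w Λ₀ εc εt T b →
        ‖b T - βstar‖ ≤ K * √(((ILAMM.supp βstar).card : ℝ) / n) := by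
  intro δ hδ hδ'
  -- The part `32σ` makes `λ` dominate the score. The other 32 gives `λ ≥ 16/√n`, as `√(log d) ≥
  -- 1/2`.
  refine ⟨2, two_pos, fun σ hσ => ⟨32 * σ + 32, by positivity, ?_⟩⟩
  intro c₁ c₂ ρlo ρhi hc₁ hc₁₂ hρlo hρ
  have hρhi : 0 < ρhi := hρlo.trans_le hρ
  have hσ' : (0 : ℝ) < σ := hσ
  have hc₁pos : 0 < c₁ := lt_of_lt_of_le (by positivity) hc₁
  have hc₂pos : 0 < c₂ := hc₁pos.trans_le hc₁₂
  refine ⟨1, 1, ρlo⁻¹ * (24 * c₂ + 36 * (√(8 * σ ^ 2 * ρhi) + 3)), one_pos, one_pos,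
    by positivity, ?_⟩
  intro n d hn hd X βstar Ω _ μ _ e w lam γ εc εt Λ₀ T hind _ hsub hX hLSE hw hwu hγ hsignal hwγ
    hlam₁ hlam₂ hεc hεt hT hTlog hΛ₀
  have hn' : (0 : ℝ) < n := by exact_mod_cast hn
  rcases Nat.eq_zero_or_pos (ILAMM.supp βstar).card with hs | hs
  -- For an empty support the term `2 exp(0)` already makes the required probability negative.
  · refine ⟨∅, MeasurableSet.empty, ?_, by simp⟩
    have : (0 : ℝ) ≤ (d : ℝ) ^ (-1 : ℝ) := by positivity
    rw [hs]
    simp only [Nat.cast_zero, mul_zero, Real.exp_zero, measureReal_empty]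
    linarith
  have hlog₂ : (1 / 4 : ℝ) ≤ Real.log d := by
    have h₁ : Real.log 2 ≤ Real.log d :=
      Real.log_le_log two_pos (by exact_mod_cast hd)
    linarith [Real.log_two_gt_d9]
  have hsqrtdiv : √(Real.log d / n) = √(Real.log d) * √(1 / (n : ℝ)) := by
    rw [← Real.sqrt_mul (by linarith), mul_one_div]
  have hhalf : 1 / 2 ≤ √(Real.log d) := by
    rw [Real.le_sqrt (by norm_num) (by linarith)]
    linarith
  set ν := √(1 / (n : ℝ)) with hν
  have hν₀ : 0 < ν := Real.sqrt_pos.2 (by positivity)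
  have hlamν : 16 * ν ≤ lam := by
    refine le_trans ?_ hlam₁
    rw [hsqrtdiv, ← mul_assoc]
    gcongr
    nlinarith
  have hlam : 0 < lam := by linarith
  have hlamσ : 32 * σ * √(Real.log d / n) ≤ lam := by
    refine le_trans ?_ hlam₁
    gcongr
    linarith
  have hu : 0 ≤ 18 * ρlo⁻¹ * δ⁻¹ * lam := by positivity
  have hw₀ : 1 / 2 ≤ w 0 := hwu.trans (hw.antitone _ _ le_rfl hu)
  have hΛ : (∀ j, lam / 2 ≤ Λ₀ j) ∧ ∀ j, Λ₀ j ≤ lam := by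
    rcases hΛ₀ with rfl | rfl
    · exact ⟨fun _ => by linarith, fun _ => le_rfl⟩
    · have h₁ := mul_le_mul_of_nonneg_left hw₀ hlam.le
      have h₂ := mul_le_mul_of_nonneg_left (hw.le_one 0 le_rfl) hlam.le
      simp only [ILAMM.adaptiveWeights, PiLp.zero_apply, abs_zero]
      exact ⟨fun _ => by linarith, fun _ => by linarith⟩
  set s := (ILAMM.supp βstar).card with hsdef
  set G : Set Ω := {ω | ∃ j, lam / 16 ≤ |ILAMM.score X (fun i => e i ω) j|} with hG
  set Q : Set Ω := {ω | 8 * σ ^ 2 * ρhi * (s / n) ≤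
    ∑ j ∈ ILAMM.supp βstar, ILAMM.score X (fun i => e i ω) j ^ 2} with hQ
  have hPG : μ.real G ≤ 2 * (d : ℝ) ^ (-1 : ℝ) :=
    ILAMM.measure_score_large_le hn hd hσ hind hsub hX hlamσ
  have hPQ : μ.real Q ≤ Real.exp (-(s : ℝ)) := by
    obtain ⟨ω₀⟩ := nonempty_of_isProbabilityMeasure μ
    obtain ⟨m, _, _, -, -, -, -, hhi, -⟩ := (hLSE ω₀).exists_bounds hs
    exact ILAMM.measure_score_supp_large_le hn hσ hind hsub hρhi _ fun u =>
      hhi _ u (by omega)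
  -- The noise is only almost everywhere measurable, so the bad event is replaced by a measurable
  -- hull of equal measure.
  refine ⟨(toMeasurable μ (G ∪ Q))ᶜ, (measurableSet_toMeasurable _ _).compl, ?_, ?_⟩
  · rw [probReal_compl_eq_one_sub (measurableSet_toMeasurable _ _)]
    have h₁ : μ.real (toMeasurable μ (G ∪ Q)) = μ.real (G ∪ Q) := by
      rw [measureReal_def, measure_toMeasurable, measureReal_def]
    have h₂ := measureReal_union_le (μ := μ) G Q
    have h₃ := Real.exp_pos (-(s : ℝ))
    rw [h₁, neg_one_mul]
    linarith
  · intro ω hω b hb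
    have hω' : ω ∉ G ∪ Q := fun h => hω (subset_toMeasurable μ _ h)
    rw [Set.mem_union, not_or] at hω'
    simp only [hG, hQ, Set.mem_ofPred_eq, not_exists, not_le] at hω'
    -- Doubling the tolerance, `η = 2/√n`, supplies the strict inequality `εt < η`; then `3/2 · 2`
    -- is the 3 in `K`.
    have hmain := hb.norm_sub_le hs (hLSE ω) hlam (fun j => (hω'.1 j).le) hw hδ hδ' hwu hγ
      hsignal hwγ hεc (η := 2 * ν) (by linarith) (by linarith) (by linarith) hΛ.1 hΛ.2 hT
    have hsn : √((s : ℝ) / n) = ν * √s := by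
      rw [hν, ← Real.sqrt_mul (by positivity), div_eq_mul_one_div, mul_comm]
    have hscore : √(∑ j ∈ ILAMM.supp βstar, ILAMM.score X (fun i => e i ω) j ^ 2) ≤
        √(8 * σ ^ 2 * ρhi) * (ν * √s) := by
      rw [← hsn, ← Real.sqrt_mul (by positivity)]
      exact Real.sqrt_le_sqrt hω'.2.le
    have hpow := ILAMM.pow_mul_sqrt_log_le_one hd hTlog
    have hfirst : (3 / 4 : ℝ) ^ T * (24 * lam * √s) ≤ 24 * c₂ * (ν * √s) := by
      calc (3 / 4 : ℝ) ^ T * (24 * lam * √s)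
          ≤ (3 / 4 : ℝ) ^ T * (24 * (c₂ * √(Real.log d / n)) * √s) := by gcongr
        _ = ((3 / 4 : ℝ) ^ T * √(Real.log d)) * (24 * c₂ * (ν * √s)) := by rw [hsqrtdiv]; ring
        _ ≤ 1 * (24 * c₂ * (ν * √s)) := by gcongr
        _ = 24 * c₂ * (ν * √s) := one_mul _
    rw [hsn, mul_assoc, ← div_eq_inv_mul, le_div_iff₀ hρlo]
    linarith
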